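/- Let $A,B,C>0$, $Mg>0$ and $x_0,y_0,z_0\in\mathbb R$, and consider the Euler–Poisson equations $$A\dot p=(B-C)qr+Mg(y_0\gamma''-z_0\gamma'),\quad B\dot q=(C-A)rp+Mg(z_0\gamma-x_0\gamma''),\quad C\dot r=(A-B)pq+Mg(x_0\gamma'-y_0\gamma),$$ $$\dot\gamma=r\gamma'-q\gamma'',\quad \dot\gamma'=p\gamma''-r\gamma,\quad \dot\gamma''=q\gamma-p\gamma'.$$ Consider formal series solutions $$(p,q,r)=t^{-1}\sum_{m\ge0}(p_m,q_m,r_m)t^m,\qquad(\gamma,\gamma',\gamma'')=t^{-2}\sum_{m\ge0}(f_m,g_m,h_m)t^m$$ with complex coefficients and $(f_0,g_0,h_0)\ne0$. Put $v_m=(p_m,q_m,r_m,f_m,g_m,h_m)$. The equations say that $v_0$ solves the leading equations $$-Ap_0=(B-C)q_0r_0+Mg(y_0h_0-z_0g_0),\quad -Bq_0=(C-A)r_0p_0+Mg(z_0f_0-x_0h_0),\quad -Cr_0=(A-B)p_0q_0+Mg(x_0g_0-y_0f_0),$$ $$-2f_0=r_0g_0-q_0h_0,\quad -2g_0=p_0h_0-r_0f_0,\quad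 -2h_0=q_0f_0-p_0g_0,$$ and that, for $m\ge1$, $L_{v_0}(m)\,v_m=S_m(v_1,\dots,v_{m-1})$. Here $L_{v_0}(m)$ is the $6\times6$ matrix of the linear equations for $v_m$ obtained by comparing coefficients; its determinant is a polynomial of degree $6$ in $m$. The right-hand side $S_m$ is a polynomial in the earlier coefficients. For a finite set $s$ of non-negative integers, call $v_0\in\mathbb C^6$ *$s$-admissible* if it solves the leading equations, $(f_0,g_0,h_0)\neq0$, $\det L_{v_0}(m)=0$ for all $m\in s$, and the linear equations are compatible: for every $m\ge1$ and every solution $v_1,\dots,v_{m-1}$ of the equations of index $1,\dots,m-1$, the equation of index $m$ is solvable. The *series conditions* hold if, for some set $s$ of five different non-negative integers, there is an $s$-admissible $v_0$ which, in case $0\in s$, is an accumulation point of the set of $s$-admissible vectors (so that an arbitrary constant really enters among the leading coefficients). Then: 1. If there is a family of such series solutions which contains five independent arbitrary constants, then the series conditions hold. (Such a family consists of solutions whose coefficients are holomorphic functions of $c$ in an open subset of $\mathbb C^5$, such that at some $c_0$ no non-zero direction annihilates the differentials of all the coefficients.) 2. If the body is not in the Euler case $x_0=y_0=z_0=0$,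 then the series conditions hold if and only if, up to the choice of the principal axes, the body is in the Lagrange case $$A=B,\quad x_0=y_0=0,$$ or in the Kowalevski case $$A=B=2C,\quad z_0=0.$$ The choice of principal axes means cyclic renaming; moreover, if $A=B=C$, every axis is principal, so that the body counts as a Lagrange case for every position of the centre of gravity. In particular, apart from the Euler and Lagrange cases, the conditions hold only in the Kowalevski case, and there they do hold. -/

import Mathlib

open scoped LaurentSeries Topology

noncomputable section

/-- A heavy rigid body with a fixed point: the principal moments of inertia `A`, `B`, `C` at the
fixed point, its weight `Mg`, and the coordinates `x₀`, `y₀`, `z₀` of the centre of gravity with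
respect to the principal axes. -/
structure HeavyBody where
  A : ℝ
  B : ℝ
  C : ℝ
  Mg : ℝ
  x₀ : ℝ
  y₀ : ℝ
  z₀ : ℝ
  A_pos : 0 < A
  B_pos : 0 < B
  C_pos : 0 < C
  Mg_pos : 0 < Mg

namespace HeavyBody

/-- The Euler case: the centre of gravity is the fixed point. -/
def IsEulerCase (b : HeavyBody) : Prop :=
  b.x₀ = 0 ∧ b.y₀ = 0 ∧ b.z₀ = 0

/-- The Lagrange case: `A = B` and `x₀ = y₀ = 0`, up to the choice of the principal axes. The axes
may be renamed cyclically; if `A = B = C`, all axes are principal, and one of them can be laid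
through the centre of gravity. -/
def IsLagrangeCase (b : HeavyBody) : Prop :=
  (b.A = b.B ∧ b.x₀ = 0 ∧ b.y₀ = 0) ∨
  (b.B = b.C ∧ b.y₀ = 0 ∧ b.z₀ = 0) ∨
  (b.C = b.A ∧ b.z₀ = 0 ∧ b.x₀ = 0) ∨
  (b.A = b.B ∧ b.B = b.C)

/-- The Kowalevski case: `A = B = 2C` and `z₀ = 0`, up to a cyclic renaming of the principal
axes. -/
def IsKowalevskiCase (b : HeavyBody) : Prop :=
  (b.A = b.B ∧ b.B = 2 * b.C ∧ b.z₀ = 0) ∨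
  (b.B = b.C ∧ b.C = 2 * b.A ∧ b.x₀ = 0) ∨
  (b.C = b.A ∧ b.A = 2 * b.B ∧ b.y₀ = 0)

/-- The Euler–Poisson equations, for formal Laurent series in the time `t`. -/
structure IsEulerPoissonSolution (b : HeavyBody) (p q r γ γ' γ'' : ℂ⸨X⸩) : Prop where
  eq_p : (b.A : ℂ) • LaurentSeries.derivative ℂ p =
    ((b.B - b.C : ℝ) : ℂ) • (q * r) + (b.Mg : ℂ) • ((b.y₀ : ℂ) • γ'' - (b.z₀ : ℂ) • γ')
  eq_q : (b.B : ℂ) • LaurentSeries.derivative ℂ q =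
    ((b.C - b.A : ℝ) : ℂ) • (r * p) + (b.Mg : ℂ) • ((b.z₀ : ℂ) • γ - (b.x₀ : ℂ) • γ'')
  eq_r : (b.C : ℂ) • LaurentSeries.derivative ℂ r =
    ((b.A - b.B : ℝ) : ℂ) • (p * q) + (b.Mg : ℂ) • ((b.x₀ : ℂ) • γ' - (b.y₀ : ℂ) • γ)
  eq_γ : LaurentSeries.derivative ℂ γ = r * γ' - q * γ''
  eq_γ' : LaurentSeries.derivative ℂ γ' = p * γ'' - r * γ
  eq_γ'' : LaurentSeries.derivative ℂ γ'' = q * γ - p * γ'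

end HeavyBody

/-- The Laurent series `t⁻ⁿ (a₀ + a₁ t + a₂ t² + ⋯)`. -/
def laurentOfCoeffs (n : ℕ) (a : ℕ → ℂ) : ℂ⸨X⸩ :=
  HahnSeries.single (-(n : ℤ)) (1 : ℂ) * HahnSeries.ofPowerSeries ℤ ℂ (PowerSeries.mk a)

namespace HeavyBody

/-- The coefficients are collected as `v m = (pₘ, qₘ, rₘ, fₘ, gₘ, hₘ)`. The series
`p = t⁻¹ ∑ pₘ tᵐ`, `q = t⁻¹ ∑ qₘ tᵐ`, `r = t⁻¹ ∑ rₘ tᵐ`, `γ = t⁻² ∑ fₘ tᵐ`, `γ' = t⁻² ∑ gₘ tᵐ`,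
`γ'' = t⁻² ∑ hₘ tᵐ` solve the Euler–Poisson equations. -/
def IsSeriesSolution (b : HeavyBody) (v : ℕ → Fin 6 → ℂ) : Prop :=
  b.IsEulerPoissonSolution
    (laurentOfCoeffs 1 fun m => v m 0) (laurentOfCoeffs 1 fun m => v m 1)
    (laurentOfCoeffs 1 fun m => v m 2) (laurentOfCoeffs 2 fun m => v m 3)
    (laurentOfCoeffs 2 fun m => v m 4) (laurentOfCoeffs 2 fun m => v m 5)

end HeavyBody

/-- The leading coefficients `(f₀, g₀, h₀)` of `γ, γ', γ''` do not all vanish, so that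
`(γ, γ', γ'')` really has a pole of order two. -/
def LeadingNonzero (v₀ : Fin 6 → ℂ) : Prop :=
  v₀ 3 ≠ 0 ∨ v₀ 4 ≠ 0 ∨ v₀ 5 ≠ 0

namespace HeavyBody

/-- The Euler–Poisson equations have a general solution in Laurent series: a family of series
solutions with pole orders `1` and `2` that contains five arbitrary constants `c`. The coefficients
depend holomorphically on `c` in an open set, and the five constants are independent: for some
`c₀`, there is no direction in which all coefficients are stationary at `c₀`. -/
def HasGeneralLaurentSolution (b : HeavyBody) : Prop :=
  ∃ (U : Set (Fin 5 → ℂ)) (v : (Fin 5 → ℂ) → ℕ → Fin 6 → ℂ),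
    IsOpen U ∧
    (∀ m, DifferentiableOn ℂ (fun c => v c m) U) ∧
    (∀ c ∈ U, b.IsSeriesSolution (v c) ∧ LeadingNonzero (v c 0)) ∧
    ∃ c₀ ∈ U, ∀ w : Fin 5 → ℂ, (∀ m, fderiv ℂ (fun c => v c m) c₀ w = 0) → w = 0

/-- The equations for the leading coefficients `v = (p₀, q₀, r₀, f₀, g₀, h₀)`. -/
structure IsLeading (b : HeavyBody) (v : Fin 6 → ℂ) : Prop where
  eq_p : -(b.A : ℂ) * v 0 = (b.B - b.C) * v 1 * v 2 + b.Mg * (b.y₀ * v 5 - b.z₀ * v 4)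
  eq_q : -(b.B : ℂ) * v 1 = (b.C - b.A) * v 2 * v 0 + b.Mg * (b.z₀ * v 3 - b.x₀ * v 5)
  eq_r : -(b.C : ℂ) * v 2 = (b.A - b.B) * v 0 * v 1 + b.Mg * (b.x₀ * v 4 - b.y₀ * v 3)
  eq_f : -2 * v 3 = v 2 * v 4 - v 1 * v 5
  eq_g : -2 * v 4 = v 0 * v 5 - v 2 * v 3
  eq_h : -2 * v 5 = v 1 * v 3 - v 0 * v 4

/-- The matrix of the linear equations for `(pₘ, qₘ, rₘ, fₘ, gₘ, hₘ)`, where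
`v = (p₀, q₀, r₀, f₀, g₀, h₀)`. Its determinant is a polynomial of degree six in `m`. -/
def recursionMatrix (b : HeavyBody) (v : Fin 6 → ℂ) (m : ℂ) : Matrix (Fin 6) (Fin 6) ℂ :=
  !![(m - 1) * b.A, -(b.B - b.C) * v 2, -(b.B - b.C) * v 1, 0, b.Mg * b.z₀, -(b.Mg * b.y₀);
     -(b.C - b.A) * v 2, (m - 1) * b.B, -(b.C - b.A) * v 0, -(b.Mg * b.z₀), 0, b.Mg * b.x₀;
     -(b.A - b.B) * v 1, -(b.A - b.B) * v 0, (m - 1) * b.C, b.Mg * b.y₀, -(b.Mg * b.x₀), 0;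
     0, v 5, -v 4, m - 2, -v 2, v 1;
     -v 5, 0, v 3, v 2, m - 2, -v 0;
     v 4, -v 3, 0, -v 1, v 0, m - 2]

/-- The right-hand sides `(Pₘ, Qₘ, Rₘ, Fₘ, Gₘ, Hₘ)` of these linear equations. They involve only
the coefficients of index `k` with `0 < k < m`. -/
def recursionRHS (b : HeavyBody) (v : ℕ → Fin 6 → ℂ) (m : ℕ) : Fin 6 → ℂ :=
  ∑ k ∈ Finset.Ioo 0 m,
    ![(b.B - b.C) * v k 1 * v (m - k) 2,
      (b.C - b.A) * v k 2 * v (m - k) 0,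
      (b.A - b.B) * v k 0 * v (m - k) 1,
      v k 2 * v (m - k) 4 - v k 1 * v (m - k) 5,
      v k 0 * v (m - k) 5 - v k 2 * v (m - k) 3,
      v k 1 * v (m - k) 3 - v k 0 * v (m - k) 4]

/-- The linear equations of index `m`. -/
def SatisfiesRecursion (b : HeavyBody) (v : ℕ → Fin 6 → ℂ) (m : ℕ) : Prop :=
  (b.recursionMatrix (v 0) m).mulVec (v m) = b.recursionRHS v m

/-- The linear equations are compatible: however the equations of index `1, …, m - 1` have been
solved, those of index `m` can be solved too. -/
def Compatible (b : HeavyBody) (v₀ : Fin 6 → ℂ) : Prop :=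
  ∀ m : ℕ, 1 ≤ m → ∀ v : ℕ → Fin 6 → ℂ, v 0 = v₀ →
    (∀ k, 1 ≤ k → k < m → b.SatisfiesRecursion v k) →
    ∃ w : Fin 6 → ℂ, (b.recursionMatrix v₀ m).mulVec w = b.recursionRHS v m

/-- Admissible leading coefficients for the set of indices `s`: they solve the leading equations
with `(f₀, g₀, h₀) ≠ 0`, the determinant vanishes at each index in `s`, and the linear equations
are compatible. -/
structure IsAdmissible (b : HeavyBody) (s : Finset ℕ) (v₀ : Fin 6 → ℂ) : Prop where
  leading : b.IsLeading v₀
  nonzero : LeadingNonzero v₀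
  det_eq_zero : ∀ m ∈ s, (b.recursionMatrix v₀ m).det = 0
  compatible : b.Compatible v₀

/-- The conditions for the series to contain five arbitrary constants: for admissible leading
coefficients the determinant vanishes at five different indices. An arbitrary constant may also
enter at the index `0`, that is, among the leading coefficients themselves; if `0` is one of the
five indices, then the leading coefficients have to be really variable, i.e. not isolated among the
admissible ones. -/
def SeriesConditions (b : HeavyBody) : Prop :=
  ∃ s : Finset ℕ, s.card = 5 ∧ ∃ v₀ : Fin 6 → ℂ, b.IsAdmissible s v₀ ∧
    (0 ∈ s → AccPt v₀ (Filter.principal {v | b.IsAdmissible s v}))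

end HeavyBody

end

/-!
Write `ω = (p₀, q₀, r₀)` and `γ = (f₀, g₀, h₀)` for the leading coefficients, `e = Mg (x₀, y₀, z₀)`,
and `I` for the diagonal matrix of the moments of inertia.

**The roots.** The recursion matrix is `L(m) = D (m - K)` with a constant diagonal matrix `D` and
`tr K = 9`. A shift of the time yields the eigenvalue `-1` of `K`, and the three classical first
integrals, of weights `2`, `3`, `4`, yield left eigenvectors for `2`, `3`, `4`. The other two
eigenvalues therefore have the sum `1` (`IsLeading.exists_roots`), so that five different
non-negative integers can be roots only if they are `0, 1, 2, 3, 4`. In this case the linear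
equations are compatible: at the indices `2`, `3`, `4` the only condition for their solvability is
the conservation of the corresponding first integral (`IsLeading.compatible`). Since `L(0)` is the
Jacobian matrix of the leading equations, the series conditions hold as soon as there is a
holomorphic curve of leading coefficients (`seriesConditions_of_curve`).

**Families with five constants.** Filter the directions in the space of constants by the first
coefficient that is not stationary. The step of index `m` of this filtration embeds into the kernel
of `L(m)`, whose dimension is at most the multiplicity of the root `m`. Since at most four roots are
positive integers, five constants require that the leading coefficients vary, and they vary along a
curve (`HasGeneralLaurentSolution.seriesConditions`).

**The classification.** Leading coefficients satisfy `2 I ω = -(e · γ) ω - (e · ω) γ`, `ω² = -4`,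
`γ × ω = -2 γ`, `γ² = γ · ω = 0` (`IsLeading.angular_momentum`), and they are determined by `ω`
(`IsLeading.eq_of_omega_eq`). Elimination of `γ` leaves the equations `AngularEquations` for `ω` and
`a = -(e · γ) / 2`. They have only finitely many solutions unless the body is in the Euler, Lagrange
or Kowalevski case (`finitelyManySquares`), whereas the series conditions require an accumulation
point. Conversely, the Lagrange case has the curve in which `ω` rotates in a plane of principal
directions orthogonal to `e`, and the Kowalevski case has the curve `ω + s γ` with constant `γ`.
-/

noncomputable section

/-! ### Roots of the determinant -/

open Polynomial in
/-- A complex `6 × 6` matrix with trace `9` and the eigenvalues `-1, 2, 3, 4` has two more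
eigenvalues, whose sum is `1`. -/
theorem Matrix.exists_charpoly_roots_eq_of_trace_eq_nine (K : Matrix (Fin 6) (Fin 6) ℂ)
    (htr : K.trace = 9) (h1 : K.charpoly.IsRoot (-1)) (h2 : K.charpoly.IsRoot 2)
    (h3 : K.charpoly.IsRoot 3) (h4 : K.charpoly.IsRoot 4) :
    ∃ ρ σ : ℂ, ρ + σ = 1 ∧ K.charpoly.roots = {-1, 2, 3, 4} + {ρ, σ} := by
  have h0 : K.charpoly ≠ 0 := K.charpoly_monic.ne_zero
  have hle : ({-1, 2, 3, 4} : Multiset ℂ) ≤ K.charpoly.roots := by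
    rw [Multiset.le_iff_subset]
    · intro x hx
      rw [mem_roots h0]
      simp only [Multiset.insert_eq_cons, Multiset.mem_cons, Multiset.mem_singleton] at hx
      rcases hx with rfl | rfl | rfl | rfl <;> assumption
    · simp only [Multiset.insert_eq_cons, Multiset.nodup_cons, Multiset.mem_cons,
        Multiset.mem_singleton, Multiset.nodup_singleton]
      norm_num
  obtain ⟨t, ht⟩ := Multiset.le_iff_exists_add.1 hle
  have hcard : K.charpoly.roots.card = 6 := by
    rw [splits_iff_card_roots.1 (IsAlgClosed.splits K.charpoly), K.charpoly_natDegree_eq_dim]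
    simp
  have ht2 : t.card = 2 := by
    rw [ht, Multiset.card_add] at hcard
    simp only [Multiset.insert_eq_cons, Multiset.card_cons, Multiset.card_singleton] at hcard
    omega
  obtain ⟨ρ, σ, rfl⟩ := Multiset.card_eq_two.1 ht2
  refine ⟨ρ, σ, ?_, ht⟩
  have hs := K.trace_eq_sum_roots_charpoly
  rw [htr, ht] at hs
  simp only [Multiset.insert_eq_cons, Multiset.sum_add, Multiset.sum_cons,
    Multiset.sum_singleton] at hs
  linear_combination -hs

/-- Two numbers with sum `1` that are both natural numbers are `0` and `1`. -/
theorem natCast_add_eq_one {a c : ℕ} (h : (a : ℂ) + c = 1) : a = 0 ∧ c = 1 ∨ a = 1 ∧ c = 0 := by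
  have : a + c = 1 := by exact_mod_cast h
  omega

namespace HeavyBody

section Leading

variable {b : HeavyBody} {v : Fin 6 → ℂ}

theorem IsLeading.perp (h : b.IsLeading v) : v 0 * v 3 + v 1 * v 4 + v 2 * v 5 = 0 := by
  obtain ⟨-, -, -, h4, h5, h6⟩ := h
  linear_combination (-1 / 2) * (v 0 * h4 + v 1 * h5 + v 2 * h6)

theorem IsLeading.omega_sq (h : b.IsLeading v) (hn : LeadingNonzero v) :
    v 0 ^ 2 + v 1 ^ 2 + v 2 ^ 2 = -4 := by
  have hp := h.perp
  obtain ⟨-, -, -, h4, h5, h6⟩ := h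
  have k3 : v 3 * (v 0 ^ 2 + v 1 ^ 2 + v 2 ^ 2 + 4) = 0 := by
    linear_combination v 0 * hp - 2 * h4 + v 2 * h5 - v 1 * h6
  have k4 : v 4 * (v 0 ^ 2 + v 1 ^ 2 + v 2 ^ 2 + 4) = 0 := by
    linear_combination v 1 * hp - 2 * h5 + v 0 * h6 - v 2 * h4
  have k5 : v 5 * (v 0 ^ 2 + v 1 ^ 2 + v 2 ^ 2 + 4) = 0 := by
    linear_combination v 2 * hp - 2 * h6 + v 1 * h4 - v 0 * h5
  rcases hn with h | h | h
  · linear_combination (mul_eq_zero.1 k3).resolve_left h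
  · linear_combination (mul_eq_zero.1 k4).resolve_left h
  · linear_combination (mul_eq_zero.1 k5).resolve_left h

end Leading

/-- The moments of inertia of the six equations of motion: the coefficients of the derivatives. -/
def massVector (b : HeavyBody) : Fin 6 → ℂ := ![b.A, b.B, b.C, 1, 1, 1]

/-- The Kowalevski matrix `K`, for which `L(m) = D (m - K)` with the diagonal matrix `D` of
`massVector`. -/
def kowalevskiMatrix (b : HeavyBody) (v : Fin 6 → ℂ) : Matrix (Fin 6) (Fin 6) ℂ :=
  -(Matrix.diagonal (b.massVector)⁻¹ * b.recursionMatrix v 0)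

theorem A_ne_zero (b : HeavyBody) : (b.A : ℂ) ≠ 0 := by exact_mod_cast b.A_pos.ne'
theorem B_ne_zero (b : HeavyBody) : (b.B : ℂ) ≠ 0 := by exact_mod_cast b.B_pos.ne'
theorem C_ne_zero (b : HeavyBody) : (b.C : ℂ) ≠ 0 := by exact_mod_cast b.C_pos.ne'
theorem Mg_ne_zero (b : HeavyBody) : (b.Mg : ℂ) ≠ 0 := by exact_mod_cast b.Mg_pos.ne'

theorem massVector_ne_zero (b : HeavyBody) (i : Fin 6) : b.massVector i ≠ 0 := by
  fin_cases i <;> simp [massVector, b.A_pos.ne', b.B_pos.ne', b.C_pos.ne']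

theorem recursionMatrix_eq_mul (b : HeavyBody) (v : Fin 6 → ℂ) (m : ℂ) :
    b.recursionMatrix v m =
      Matrix.diagonal b.massVector * (Matrix.scalar (Fin 6) m - b.kowalevskiMatrix v) := by
  have h : Matrix.diagonal b.massVector * Matrix.diagonal (b.massVector)⁻¹ = 1 := by
    rw [Matrix.diagonal_mul_diagonal, ← Matrix.diagonal_one]
    congr 1
    ext i
    simp [b.massVector_ne_zero i]
  rw [kowalevskiMatrix, sub_neg_eq_add, mul_add, ← mul_assoc, h, one_mul, Matrix.scalar_apply,
    Matrix.diagonal_mul_diagonal]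
  ext i j
  fin_cases i <;> fin_cases j <;> simp [recursionMatrix, massVector] <;> ring

theorem trace_kowalevskiMatrix (b : HeavyBody) (v : Fin 6 → ℂ) :
    (b.kowalevskiMatrix v).trace = 9 := by
  have hA := b.A_ne_zero
  have hB := b.B_ne_zero
  have hC := b.C_ne_zero
  simp only [kowalevskiMatrix, Matrix.trace, Matrix.diag_apply, Fin.sum_univ_six]
  simp [recursionMatrix, massVector, hA, hB, hC]
  norm_num

theorem det_recursionMatrix (b : HeavyBody) (v : Fin 6 → ℂ) (m : ℂ) :
    (b.recursionMatrix v m).det =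
      (∏ i, b.massVector i) * (b.kowalevskiMatrix v).charpoly.eval m := by
  rw [recursionMatrix_eq_mul, Matrix.det_mul, Matrix.det_diagonal, Matrix.eval_charpoly]

theorem det_recursionMatrix_eq_zero_iff (b : HeavyBody) (v : Fin 6 → ℂ) (m : ℂ) :
    (b.recursionMatrix v m).det = 0 ↔ m ∈ (b.kowalevskiMatrix v).charpoly.roots := by
  rw [det_recursionMatrix, Polynomial.mem_roots (Matrix.charpoly_monic _).ne_zero,
    mul_eq_zero, or_iff_right (Finset.prod_ne_zero_iff.2 fun i _ => b.massVector_ne_zero i)]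
  rfl

theorem finrank_ker_recursionMatrix_le (b : HeavyBody) (v : Fin 6 → ℂ) (m : ℂ) :
    Module.finrank ℂ (LinearMap.ker (b.recursionMatrix v m).mulVecLin) ≤
      (b.kowalevskiMatrix v).charpoly.roots.count m := by
  rw [Polynomial.count_roots, ← Matrix.charpoly_toLin']
  refine le_trans (Submodule.finrank_mono ?_)
    (LinearMap.finrank_eigenspace_le (Matrix.toLin' (b.kowalevskiMatrix v)) m)
  intro w hw
  rw [LinearMap.mem_ker, Matrix.mulVecLin_apply, recursionMatrix_eq_mul,
    ← Matrix.mulVec_mulVec] at hw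
  have hw' : (Matrix.scalar (Fin 6) m - b.kowalevskiMatrix v).mulVec w = 0 := by
    ext i
    have := congrFun hw i
    rw [Matrix.mulVec_diagonal] at this
    exact (mul_eq_zero.1 this).resolve_left (b.massVector_ne_zero i)
  rw [Module.End.mem_eigenspace_iff, Matrix.toLin'_apply]
  rw [Matrix.sub_mulVec, sub_eq_zero, Matrix.scalar_apply] at hw'
  rw [← hw']
  ext i
  simp [Matrix.mulVec_diagonal]

section Roots

variable {b : HeavyBody} {v : Fin 6 → ℂ}

/-- The gradient of the energy `(A p² + B q² + C r²)/2 - Mg (x₀ γ + y₀ γ' + z₀ γ'')` at the leading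
coefficients, in which the first three components are divided by `A`, `B`, `C`: these are factors of
the first three rows of the recursion matrix. -/
def energyGradient (b : HeavyBody) (v : Fin 6 → ℂ) : Fin 6 → ℂ :=
  ![v 0, v 1, v 2, -(b.Mg * b.x₀), -(b.Mg * b.y₀), -(b.Mg * b.z₀)]

/-- The gradient of the vertical angular momentum `A p γ + B q γ' + C r γ''`, in which the first
three components are divided by `A`, `B`, `C`, as in `energyGradient`. -/
def momentumGradient (b : HeavyBody) (v : Fin 6 → ℂ) : Fin 6 → ℂ :=
  ![v 3, v 4, v 5, b.A * v 0, b.B * v 1, b.C * v 2]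

/-- Half the gradient of `γ² + γ'² + γ''²`. -/
def verticalGradient (v : Fin 6 → ℂ) : Fin 6 → ℂ :=
  ![0, 0, 0, v 3, v 4, v 5]

theorem IsLeading.energyGradient_vecMul (h : b.IsLeading v) :
    Matrix.vecMul (b.energyGradient v) (b.recursionMatrix v 2) = 0 := by
  obtain ⟨h1, h2, h3, h4, h5, h6⟩ := h
  ext j
  fin_cases j <;>
    simp [energyGradient, recursionMatrix, Matrix.vecMul, dotProduct, Fin.sum_univ_six]
  · linear_combination -h1
  · linear_combination -h2
  · linear_combination -h3
  all_goals ring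

theorem IsLeading.momentumGradient_vecMul (h : b.IsLeading v) :
    Matrix.vecMul (b.momentumGradient v) (b.recursionMatrix v 3) = 0 := by
  obtain ⟨h1, h2, h3, h4, h5, h6⟩ := h
  ext j
  fin_cases j <;>
    simp [momentumGradient, recursionMatrix, Matrix.vecMul, dotProduct, Fin.sum_univ_six]
  · linear_combination -b.A * h4
  · linear_combination -b.B * h5
  · linear_combination -b.C * h6
  · linear_combination -h1
  · linear_combination -h2
  · linear_combination -h3

theorem IsLeading.verticalGradient_vecMul (h : b.IsLeading v) :
    Matrix.vecMul (verticalGradient v) (b.recursionMatrix v 4) = 0 := by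
  obtain ⟨h1, h2, h3, h4, h5, h6⟩ := h
  ext j
  fin_cases j <;>
    simp [verticalGradient, recursionMatrix, Matrix.vecMul, dotProduct, Fin.sum_univ_six]
  · ring
  · ring
  · ring
  · linear_combination -h4
  · linear_combination -h5
  · linear_combination -h6

/-- The derivative of the leading solution with respect to a shift of the time. -/
theorem IsLeading.recursionMatrix_neg_one_mulVec (h : b.IsLeading v) :
    (b.recursionMatrix v (-1)).mulVec
      ![v 0, v 1, v 2, 2 * v 3, 2 * v 4, 2 * v 5] = 0 := by
  obtain ⟨h1, h2, h3, h4, h5, h6⟩ := h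
  ext j
  fin_cases j <;>
    simp [recursionMatrix, Matrix.mulVec, dotProduct, Fin.sum_univ_six]
  · linear_combination 2 * h1
  · linear_combination 2 * h2
  · linear_combination 2 * h3
  · linear_combination 3 * h4
  · linear_combination 3 * h5
  · linear_combination 3 * h6

theorem energyGradient_ne_zero (h : b.IsLeading v) (hn : LeadingNonzero v) :
    b.energyGradient v ≠ 0 := by
  intro h0
  have hs := h.omega_sq hn
  have k0 := congrFun h0 0
  have k1 := congrFun h0 1
  have k2 := congrFun h0 2
  simp [energyGradient] at k0 k1 k2
  simp [k0, k1, k2] at hs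

theorem momentumGradient_ne_zero (hn : LeadingNonzero v) : b.momentumGradient v ≠ 0 := by
  intro h0
  have k0 := congrFun h0 0
  have k1 := congrFun h0 1
  have k2 := congrFun h0 2
  simp [momentumGradient] at k0 k1 k2
  simp [LeadingNonzero, k0, k1, k2] at hn

theorem verticalGradient_ne_zero (hn : LeadingNonzero v) : verticalGradient v ≠ 0 := by
  intro h0
  have k0 := congrFun h0 3
  have k1 := congrFun h0 4
  have k2 := congrFun h0 5
  simp [verticalGradient] at k0 k1 k2
  simp [LeadingNonzero, k0, k1, k2] at hn

/-- The roots of the determinant: `-1` belongs to shifts of the time, and `2`, `3`, `4` are the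
weights of the three first integrals. -/
theorem IsLeading.exists_roots (h : b.IsLeading v) (hn : LeadingNonzero v) :
    ∃ ρ σ : ℂ, ρ + σ = 1 ∧
      (b.kowalevskiMatrix v).charpoly.roots = {-1, 2, 3, 4} + {ρ, σ} := by
  have key : ∀ m : ℂ, (b.recursionMatrix v m).det = 0 →
      (b.kowalevskiMatrix v).charpoly.IsRoot m := fun m hm =>
    Polynomial.isRoot_of_mem_roots ((b.det_recursionMatrix_eq_zero_iff v m).1 hm)
  refine Matrix.exists_charpoly_roots_eq_of_trace_eq_nine _ (b.trace_kowalevskiMatrix v)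
    (key _ ?_) (key _ ?_) (key _ ?_) (key _ ?_)
  · refine Matrix.exists_mulVec_eq_zero_iff.1 ⟨_, ?_, h.recursionMatrix_neg_one_mulVec⟩
    intro h0
    have k0 := congrFun h0 3
    have k1 := congrFun h0 4
    have k2 := congrFun h0 5
    simp at k0 k1 k2
    simp [LeadingNonzero, k0, k1, k2] at hn
  · exact Matrix.exists_vecMul_eq_zero_iff.1
      ⟨_, energyGradient_ne_zero h hn, h.energyGradient_vecMul⟩
  · exact Matrix.exists_vecMul_eq_zero_iff.1
      ⟨_, momentumGradient_ne_zero hn, h.momentumGradient_vecMul⟩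
  · exact Matrix.exists_vecMul_eq_zero_iff.1
      ⟨_, verticalGradient_ne_zero hn, h.verticalGradient_vecMul⟩

theorem IsLeading.roots_eq_of_det_zero (h : b.IsLeading v) (hn : LeadingNonzero v)
    (h0 : (b.recursionMatrix v 0).det = 0) :
    (b.kowalevskiMatrix v).charpoly.roots = {-1, 2, 3, 4, 0, 1} := by
  obtain ⟨ρ, σ, hs, hr⟩ := h.exists_roots hn
  rw [det_recursionMatrix_eq_zero_iff, hr] at h0
  simp at h0
  rw [hr]
  rcases h0 with rfl | rfl
  · obtain rfl : σ = 1 := by linear_combination hs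
    rfl
  · obtain rfl : ρ = 1 := by linear_combination hs
    rw [Multiset.pair_comm 1 0]
    rfl

/-- Five different non-negative integers can be roots of the determinant only if they are
`0, 1, 2, 3, 4`, because the two unknown roots have the sum `1`. -/
theorem IsLeading.zero_mem_of_card (h : b.IsLeading v) (hn : LeadingNonzero v) {s : Finset ℕ}
    (hs : s.card = 5) (hd : ∀ m ∈ s, (b.recursionMatrix v m).det = 0) : 0 ∈ s := by
  obtain ⟨ρ, σ, hsum, hr⟩ := h.exists_roots hn
  have hmem : ∀ m ∈ s, m = 2 ∨ m = 3 ∨ m = 4 ∨ (m : ℂ) = ρ ∨ (m : ℂ) = σ := by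
    intro m hm
    have := hd m hm
    rw [det_recursionMatrix_eq_zero_iff, hr] at this
    simp only [Multiset.insert_eq_cons, Multiset.mem_add, Multiset.mem_cons,
      Multiset.mem_singleton] at this
    rcases this with (h | h | h | h) | h | h
    · exact absurd (by linear_combination h) (Nat.cast_add_one_ne_zero (R := ℂ) m)
    · exact Or.inl (by exact_mod_cast h)
    · exact Or.inr (Or.inl (by exact_mod_cast h))
    · exact Or.inr (Or.inr (Or.inl (by exact_mod_cast h)))
    · simp [h]
    · simp [h]
  by_contra hs0
  -- otherwise two different elements outside of `{2, 3, 4}` are `ρ` and `σ`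
  have hcard : 2 ≤ (s \ {2, 3, 4}).card := by
    have := Finset.le_card_sdiff {2, 3, 4} s
    have h3 : ({2, 3, 4} : Finset ℕ).card = 3 := rfl
    omega
  obtain ⟨x, hx, y, hy, hxy⟩ := Finset.one_lt_card.1 hcard
  simp only [Finset.mem_sdiff, Finset.mem_insert, Finset.mem_singleton, not_or] at hx hy
  have hx0 : x ≠ 0 := fun h => hs0 (h ▸ hx.1)
  have hy0 : y ≠ 0 := fun h => hs0 (h ▸ hy.1)
  have key : (x : ℂ) + y = 1 := by
    rcases hmem x hx.1 with h | h | h | h | h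
    · exact absurd h hx.2.1
    · exact absurd h hx.2.2.1
    · exact absurd h hx.2.2.2
    all_goals
      rcases hmem y hy.1 with h' | h' | h' | h' | h'
      · exact absurd h' hy.2.1
      · exact absurd h' hy.2.2.1
      · exact absurd h' hy.2.2.2
    · exact absurd (Nat.cast_injective (h.trans h'.symm)) hxy
    · rw [h, h', hsum]
    · rw [h, h', add_comm, hsum]
    · exact absurd (Nat.cast_injective (h.trans h'.symm)) hxy
  rcases natCast_add_eq_one key with h | h
  · exact hx0 h.1
  · exact hy0 h.2

end Roots

end HeavyBody

/-! ### Compatibility of the linear equations, and curves of leading coefficients -/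

/-- If the kernel of a square matrix is at most a line, a non-zero vector `l` with `l M = 0` spans
the conditions for the solvability of `M w = y`. -/
theorem Matrix.exists_mulVec_eq_of_dotProduct_eq_zero {n : Type*} [Fintype n] [DecidableEq n]
    (M : Matrix n n ℂ) (hM : Module.finrank ℂ (LinearMap.ker M.mulVecLin) ≤ 1) {l : n → ℂ}
    (hl : l ≠ 0) (hlM : Matrix.vecMul l M = 0) {y : n → ℂ} (hy : dotProduct l y = 0) :
    ∃ w, M.mulVec w = y := by
  let φ : (n → ℂ) →ₗ[ℂ] ℂ := dotProductBilin ℂ ℂ l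
  have hφ : ∀ w, φ w = dotProduct l w := fun w => rfl
  have hle : LinearMap.range M.mulVecLin ≤ LinearMap.ker φ := by
    rintro _ ⟨w, rfl⟩
    rw [LinearMap.mem_ker, hφ, Matrix.mulVecLin_apply, Matrix.dotProduct_mulVec, hlM,
      zero_dotProduct]
  have hφ0 : LinearMap.range φ ≠ ⊥ := by
    intro h
    refine hl (dotProduct_eq_zero_iff.1 fun w => ?_)
    rw [← hφ, LinearMap.range_eq_bot.1 h, LinearMap.zero_apply]
  have h1 := LinearMap.finrank_range_add_finrank_ker M.mulVecLin
  have h2 := LinearMap.finrank_range_add_finrank_ker φ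
  have h3 : 0 < Module.finrank ℂ (LinearMap.range φ) :=
    Nat.pos_of_ne_zero fun h => hφ0 (Submodule.finrank_eq_zero.1 h)
  have heq := Submodule.eq_of_le_of_finrank_le hle (by omega)
  have : y ∈ LinearMap.range M.mulVecLin := by rw [heq]; exact hy
  exact this

namespace HeavyBody

section Compatible

variable {b : HeavyBody} {v : ℕ → Fin 6 → ℂ}

theorem SatisfiesRecursion.apply {m : ℕ} (h : b.SatisfiesRecursion v m) (i : Fin 6) :
    ∑ j, b.recursionMatrix (v 0) m i j * v m j = b.recursionRHS v m i :=
  congrFun h i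

/-- Coefficient of index `2` in the conservation of the energy. -/
theorem energyGradient_dotProduct_recursionRHS (h1 : b.SatisfiesRecursion v 1) :
    dotProduct (b.energyGradient (v 0)) (b.recursionRHS v 2) = 0 := by
  have i2 : Finset.Ioo 0 2 = {1} := rfl
  have i1 : Finset.Ioo 0 1 = ∅ := rfl
  have e0 := h1.apply 0
  have e1 := h1.apply 1
  have e2 := h1.apply 2
  have e3 := h1.apply 3
  have e4 := h1.apply 4
  have e5 := h1.apply 5
  simp only [dotProduct, Fin.sum_univ_six, recursionMatrix, recursionRHS, i2, i1,
    Finset.sum_singleton, Finset.sum_empty, Finset.sum_apply, energyGradient, Matrix.of_apply,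
    Matrix.cons_val, Nat.reduceSub, Nat.cast_one]
    at e0 e1 e2 e3 e4 e5 ⊢
  linear_combination v 1 0 * e0 + v 1 1 * e1 + v 1 2 * e2

/-- Coefficient of index `3` in the conservation of the angular momentum. -/
theorem momentumGradient_dotProduct_recursionRHS (h1 : b.SatisfiesRecursion v 1)
    (h2 : b.SatisfiesRecursion v 2) :
    dotProduct (b.momentumGradient (v 0)) (b.recursionRHS v 3) = 0 := by
  have i3 : Finset.Ioo 0 3 = {1, 2} := rfl
  have i2 : Finset.Ioo 0 2 = {1} := rfl
  have i1 : Finset.Ioo 0 1 = ∅ := rfl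
  have n12 : (1 : ℕ) ∉ ({2} : Finset ℕ) := by decide
  have e := h1.apply
  have d := h2.apply
  simp only [Fin.forall_fin_succ, dotProduct, Fin.sum_univ_six,
    recursionMatrix, recursionRHS, i3, i2, i1, Finset.sum_insert n12,
    Finset.sum_singleton, Finset.sum_empty, Finset.sum_apply, momentumGradient, Matrix.of_apply,
    Matrix.cons_val, Nat.reduceSub, Nat.cast_ofNat, Nat.cast_one,
    Fin.succ_zero_eq_one, Fin.succ_one_eq_two, Fin.reduceSucc] at e d ⊢
  obtain ⟨e0, e1, e2, e3, e4, e5, -⟩ := e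
  obtain ⟨d0, d1, d2, d3, d4, d5, -⟩ := d
  linear_combination v 1 3 * d0 + v 1 4 * d1 + v 1 5 * d2
    + b.A * v 1 0 * d3 + b.B * v 1 1 * d4 + b.C * v 1 2 * d5
    + v 2 3 * e0 + v 2 4 * e1 + v 2 5 * e2
    + b.A * v 2 0 * e3 + b.B * v 2 1 * e4 + b.C * v 2 2 * e5

/-- Coefficient of index `4` in the conservation of `γ² + γ'² + γ''²`. -/
theorem verticalGradient_dotProduct_recursionRHS (h1 : b.SatisfiesRecursion v 1)
    (h2 : b.SatisfiesRecursion v 2) (h3 : b.SatisfiesRecursion v 3) :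
    dotProduct (verticalGradient (v 0)) (b.recursionRHS v 4) = 0 := by
  have i4 : Finset.Ioo 0 4 = {1, 2, 3} := rfl
  have i3 : Finset.Ioo 0 3 = {1, 2} := rfl
  have i2 : Finset.Ioo 0 2 = {1} := rfl
  have i1 : Finset.Ioo 0 1 = ∅ := rfl
  have n12 : (1 : ℕ) ∉ ({2} : Finset ℕ) := by decide
  have n23 : (2 : ℕ) ∉ ({3} : Finset ℕ) := by decide
  have n123 : (1 : ℕ) ∉ ({2, 3} : Finset ℕ) := by decide
  have e := h1.apply
  have d := h2.apply
  have c := h3.apply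
  simp only [Fin.forall_fin_succ, dotProduct, Fin.sum_univ_six,
    recursionMatrix, recursionRHS, i4, i3, i2, i1, Finset.sum_insert n12, Finset.sum_insert n23,
    Finset.sum_insert n123,
    Finset.sum_singleton, Finset.sum_empty, Finset.sum_apply, verticalGradient, Matrix.of_apply,
    Matrix.cons_val, Nat.reduceSub, Nat.cast_ofNat, Nat.cast_one,
    Fin.succ_zero_eq_one, Fin.succ_one_eq_two, Fin.reduceSucc] at e d c ⊢
  obtain ⟨e0, e1, e2, e3, e4, e5, -⟩ := e
  obtain ⟨d0, d1, d2, d3, d4, d5, -⟩ := d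
  obtain ⟨c0, c1, c2, c3, c4, c5, -⟩ := c
  linear_combination v 1 3 * c3 + v 1 4 * c4 + v 1 5 * c5
    + v 2 3 * d3 + v 2 4 * d4 + v 2 5 * d5
    + v 3 3 * e3 + v 3 4 * e4 + v 3 5 * e5

/-- If the two unknown roots are `0` and `1`, the linear equations are compatible: the first ones
are homogeneous, those of index `2, 3, 4` are compatible because of the three first integrals,
and the matrix is regular for all larger indices. -/
theorem IsLeading.compatible {v₀ : Fin 6 → ℂ} (h : b.IsLeading v₀) (hn : LeadingNonzero v₀)
    (h0 : (b.recursionMatrix v₀ 0).det = 0) : b.Compatible v₀ := by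
  intro m hm v hv hrec
  have hroots := h.roots_eq_of_det_zero hn h0
  have hker : ∀ k : ℂ, Module.finrank ℂ (LinearMap.ker (b.recursionMatrix v₀ k).mulVecLin) ≤ 1 := by
    intro k
    refine (b.finrank_ker_recursionMatrix_le v₀ k).trans ?_
    rw [hroots]
    refine Multiset.nodup_iff_count_le_one.1 ?_ k
    simp only [Multiset.insert_eq_cons, Multiset.nodup_cons, Multiset.mem_cons,
      Multiset.mem_singleton, Multiset.nodup_singleton]
    norm_num
  subst hv
  by_cases hm1 : m = 1
  · subst hm1
    refine ⟨0, ?_⟩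
    have i1 : Finset.Ioo 0 1 = (∅ : Finset ℕ) := rfl
    rw [recursionRHS, i1, Finset.sum_empty, Matrix.mulVec_zero]
  by_cases hm2 : m = 2
  · subst hm2
    exact Matrix.exists_mulVec_eq_of_dotProduct_eq_zero _ (hker _)
      (energyGradient_ne_zero h hn) (by simpa using h.energyGradient_vecMul)
      (energyGradient_dotProduct_recursionRHS (hrec 1 (by norm_num) (by norm_num)))
  by_cases hm3 : m = 3
  · subst hm3
    exact Matrix.exists_mulVec_eq_of_dotProduct_eq_zero _ (hker _)
      (momentumGradient_ne_zero hn) (by simpa using h.momentumGradient_vecMul)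
      (momentumGradient_dotProduct_recursionRHS (hrec 1 (by norm_num) (by norm_num))
        (hrec 2 (by norm_num) (by norm_num)))
  by_cases hm4 : m = 4
  · subst hm4
    exact Matrix.exists_mulVec_eq_of_dotProduct_eq_zero _ (hker _)
      (verticalGradient_ne_zero hn) (by simpa using h.verticalGradient_vecMul)
      (verticalGradient_dotProduct_recursionRHS (hrec 1 (by norm_num) (by norm_num))
        (hrec 2 (by norm_num) (by norm_num)) (hrec 3 (by norm_num) (by norm_num)))
  have hdet : (b.recursionMatrix (v 0) m).det ≠ 0 := by
    rw [Ne, det_recursionMatrix_eq_zero_iff, hroots]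
    simp only [Multiset.insert_eq_cons, Multiset.mem_cons, Multiset.mem_singleton, not_or]
    refine ⟨fun h' => ?_, ?_, ?_, ?_, ?_, ?_⟩
    · exact absurd (by linear_combination h') (Nat.cast_add_one_ne_zero (R := ℂ) m)
    · exact_mod_cast hm2
    · exact_mod_cast hm3
    · exact_mod_cast hm4
    · exact_mod_cast (by omega : m ≠ 0)
    · exact_mod_cast hm1
  refine ⟨(b.recursionMatrix (v 0) m)⁻¹.mulVec (b.recursionRHS v m), ?_⟩
  rw [Matrix.mulVec_mulVec, Matrix.mul_nonsing_inv _ (isUnit_iff_ne_zero.2 hdet),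
    Matrix.one_mulVec]

theorem IsLeading.isAdmissible {v₀ : Fin 6 → ℂ} (h : b.IsLeading v₀) (hn : LeadingNonzero v₀)
    (h0 : (b.recursionMatrix v₀ 0).det = 0) : b.IsAdmissible {0, 1, 2, 3, 4} v₀ := by
  refine ⟨h, hn, fun m hm => ?_, h.compatible hn h0⟩
  rw [det_recursionMatrix_eq_zero_iff, h.roots_eq_of_det_zero hn h0]
  simp only [Finset.mem_insert, Finset.mem_singleton] at hm
  rcases hm with rfl | rfl | rfl | rfl | rfl <;> simp

end Compatible

section Curve

variable {b : HeavyBody}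

/-- The recursion matrix of index `0` is the Jacobian matrix of the leading equations. -/
theorem recursionMatrix_zero_mulVec_deriv {φ : ℂ → Fin 6 → ℂ} {z : ℂ} {w : Fin 6 → ℂ}
    (hφ : ∀ᶠ x in 𝓝 z, b.IsLeading (φ x)) (hd : HasDerivAt φ w z) :
    (b.recursionMatrix (φ z) 0).mulVec w = 0 := by
  have hc : ∀ i, HasDerivAt (fun x => φ x i) (w i) z := hasDerivAt_pi.1 hd
  have key : ∀ {F G : ℂ → ℂ} {F' G' : ℂ}, HasDerivAt F F' z → HasDerivAt G G' z →
      (∀ᶠ x in 𝓝 z, F x = G x) → F' = G' := fun hF hG h =>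
    hF.unique (hG.congr_of_eventuallyEq h)
  have e0 := key ((hc 0).const_mul _)
    ((((hc 1).const_mul _).mul (hc 2)).add
      ((((hc 5).const_mul _).sub ((hc 4).const_mul _)).const_mul _)) (hφ.mono fun x h => h.eq_p)
  have e1 := key ((hc 1).const_mul _)
    ((((hc 2).const_mul _).mul (hc 0)).add
      ((((hc 3).const_mul _).sub ((hc 5).const_mul _)).const_mul _)) (hφ.mono fun x h => h.eq_q)
  have e2 := key ((hc 2).const_mul _)
    ((((hc 0).const_mul _).mul (hc 1)).add
      ((((hc 4).const_mul _).sub ((hc 3).const_mul _)).const_mul _)) (hφ.mono fun x h => h.eq_r)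
  have e3 := key ((hc 3).const_mul _) (((hc 2).mul (hc 4)).sub ((hc 1).mul (hc 5)))
    (hφ.mono fun x h => h.eq_f)
  have e4 := key ((hc 4).const_mul _) (((hc 0).mul (hc 5)).sub ((hc 2).mul (hc 3)))
    (hφ.mono fun x h => h.eq_g)
  have e5 := key ((hc 5).const_mul _) (((hc 1).mul (hc 3)).sub ((hc 0).mul (hc 4)))
    (hφ.mono fun x h => h.eq_h)
  ext i
  fin_cases i <;> simp [recursionMatrix, Matrix.mulVec, dotProduct, Fin.sum_univ_six]
  · linear_combination e0
  · linear_combination e1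
  · linear_combination e2
  · linear_combination e3
  · linear_combination e4
  · linear_combination e5

/-- A holomorphic curve of leading coefficients suffices for the series conditions: its tangent
vectors are in the kernel of the recursion matrix of index `0`. -/
theorem seriesConditions_of_curve {φ : ℂ → Fin 6 → ℂ} {U : Set ℂ} (hU : IsOpen U) {z : ℂ}
    (hz : z ∈ U) (hφ : DifferentiableOn ℂ φ U) (hl : ∀ x ∈ U, b.IsLeading (φ x))
    (hn : ∀ x ∈ U, LeadingNonzero (φ x)) (hd : deriv φ z ≠ 0) : b.SeriesConditions := by
  have hev : ∀ᶠ x in 𝓝 z, b.IsAdmissible {0, 1, 2, 3, 4} (φ x) := by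
    have hcont : ContinuousAt (deriv φ) z :=
      (hφ.deriv hU).continuousOn.continuousAt (hU.mem_nhds hz)
    filter_upwards [hcont.eventually_ne hd, hU.mem_nhds hz] with x hx hxU
    refine (hl x hxU).isAdmissible (hn x hxU) (Matrix.exists_mulVec_eq_zero_iff.1 ⟨_, hx, ?_⟩)
    exact recursionMatrix_zero_mulVec_deriv
      (Filter.eventually_of_mem (hU.mem_nhds hxU) hl)
      (hφ.differentiableAt (hU.mem_nhds hxU)).hasDerivAt
  have hda : HasDerivAt φ (deriv φ z) z := (hφ.differentiableAt (hU.mem_nhds hz)).hasDerivAt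
  refine ⟨{0, 1, 2, 3, 4}, rfl, φ z, hev.self_of_nhds, fun _ => ?_⟩
  rw [accPt_iff_frequently]
  have h1 : ∀ᶠ x in 𝓝[≠] z, φ x ≠ φ z ∧ φ x ∈ {v | b.IsAdmissible {0, 1, 2, 3, 4} v} :=
    (hda.eventually_ne hd).and (hev.filter_mono nhdsWithin_le_nhds)
  exact (hda.continuousAt.mono_left nhdsWithin_le_nhds).frequently h1.frequently

end Curve

end HeavyBody

/-! ### Coefficients of the Laurent series -/

section LaurentCoefficients

theorem laurentOfCoeffs_coeff (n : ℕ) (a : ℕ → ℂ) (m : ℕ) :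
    (laurentOfCoeffs n a).coeff ((m : ℤ) - n) = a m := by
  have h := HahnSeries.coeff_single_mul_add (r := (1 : ℂ)) (b := (-(n : ℤ)))
    (x := HahnSeries.ofPowerSeries ℤ ℂ (PowerSeries.mk a)) (a := (m : ℤ))
  rw [laurentOfCoeffs, sub_eq_add_neg, h, one_mul]
  simp [HahnSeries.ofPowerSeries_apply_coeff]

theorem laurentOfCoeffs_mul (n k : ℕ) (a c : ℕ → ℂ) :
    laurentOfCoeffs n a * laurentOfCoeffs k c =
      laurentOfCoeffs (n + k) fun m =>
        ∑ ij ∈ Finset.HasAntidiagonal.antidiagonal m, a ij.1 * c ij.2 := by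
  have h : (PowerSeries.mk a * PowerSeries.mk c : PowerSeries ℂ) =
      PowerSeries.mk fun m => ∑ ij ∈ Finset.HasAntidiagonal.antidiagonal m, a ij.1 * c ij.2 := by
    ext m
    simp [PowerSeries.coeff_mul]
  have hs : (HahnSeries.single (-((n + k : ℕ) : ℤ)) (1 : ℂ)) =
      HahnSeries.single (-(n : ℤ)) 1 * HahnSeries.single (-(k : ℤ)) 1 := by
    rw [HahnSeries.single_mul_single, Nat.cast_add, neg_add, one_mul]
  rw [laurentOfCoeffs, laurentOfCoeffs, laurentOfCoeffs, ← h, map_mul, hs,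
    mul_mul_mul_comm]

theorem coeff_mul_laurentOfCoeffs (n k : ℕ) (a c : ℕ → ℂ) (m : ℕ) :
    (laurentOfCoeffs n a * laurentOfCoeffs k c).coeff ((m : ℤ) - (n + k : ℕ)) =
      ∑ ij ∈ Finset.HasAntidiagonal.antidiagonal m, a ij.1 * c ij.2 := by
  rw [laurentOfCoeffs_mul, laurentOfCoeffs_coeff]

theorem coeff_derivative_laurentOfCoeffs (n : ℕ) (a : ℕ → ℂ) (m : ℕ) :
    (LaurentSeries.derivative ℂ (laurentOfCoeffs n a)).coeff ((m : ℤ) - (n + 1 : ℕ)) =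
      ((m : ℂ) - n) * a m := by
  rw [LaurentSeries.derivative_apply, LaurentSeries.hasseDeriv_coeff]
  have : (m : ℤ) - (n + 1 : ℕ) + (1 : ℕ) = m - n := by push_cast; ring
  rw [this, laurentOfCoeffs_coeff]
  simp

theorem sum_antidiagonal_eq_add_sum_Ioo (F : ℕ → ℕ → ℂ) {m : ℕ} (hm : 1 ≤ m) :
    ∑ ij ∈ Finset.HasAntidiagonal.antidiagonal m, F ij.1 ij.2 =
      F 0 m + F m 0 + ∑ k ∈ Finset.Ioo 0 m, F k (m - k) := by
  rw [Finset.Nat.sum_antidiagonal_eq_sum_range_succ F m, Finset.range_eq_Ico,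
    Finset.sum_Ico_succ_top (Nat.zero_le m), Finset.sum_eq_sum_Ico_succ_bot hm]
  have : Finset.Ico (0 + 1) m = Finset.Ioo 0 m := by ext; simp; omega
  rw [this, Nat.sub_zero, Nat.sub_self]
  ring

end LaurentCoefficients

namespace HeavyBody

section Series

variable {b : HeavyBody} {v : ℕ → Fin 6 → ℂ}

theorem IsSeriesSolution.coeff_eq (h : b.IsSeriesSolution v) (m : ℕ) :
    b.A * (((m : ℂ) - 1) * v m 0) =
        (b.B - b.C) * ∑ ij ∈ Finset.HasAntidiagonal.antidiagonal m, v ij.1 1 * v ij.2 2 +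
          b.Mg * (b.y₀ * v m 5 - b.z₀ * v m 4) ∧
    b.B * (((m : ℂ) - 1) * v m 1) =
        (b.C - b.A) * ∑ ij ∈ Finset.HasAntidiagonal.antidiagonal m, v ij.1 2 * v ij.2 0 +
          b.Mg * (b.z₀ * v m 3 - b.x₀ * v m 5) ∧
    b.C * (((m : ℂ) - 1) * v m 2) =
        (b.A - b.B) * ∑ ij ∈ Finset.HasAntidiagonal.antidiagonal m, v ij.1 0 * v ij.2 1 +
          b.Mg * (b.x₀ * v m 4 - b.y₀ * v m 3) ∧
    ((m : ℂ) - 2) * v m 3 = ∑ ij ∈ Finset.HasAntidiagonal.antidiagonal m, v ij.1 2 * v ij.2 4 -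
      ∑ ij ∈ Finset.HasAntidiagonal.antidiagonal m, v ij.1 1 * v ij.2 5 ∧
    ((m : ℂ) - 2) * v m 4 = ∑ ij ∈ Finset.HasAntidiagonal.antidiagonal m, v ij.1 0 * v ij.2 5 -
      ∑ ij ∈ Finset.HasAntidiagonal.antidiagonal m, v ij.1 2 * v ij.2 3 ∧
    ((m : ℂ) - 2) * v m 5 = ∑ ij ∈ Finset.HasAntidiagonal.antidiagonal m, v ij.1 1 * v ij.2 3 -
      ∑ ij ∈ Finset.HasAntidiagonal.antidiagonal m, v ij.1 0 * v ij.2 4 := by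
  obtain ⟨h1, h2, h3, h4, h5, h6⟩ := h
  have hd := coeff_derivative_laurentOfCoeffs
  have hp := coeff_mul_laurentOfCoeffs 1 1
  have hq := coeff_mul_laurentOfCoeffs 1 2
  refine ⟨?_, ?_, ?_, ?_, ?_, ?_⟩
  · have := congrArg (fun s => HahnSeries.coeff s ((m : ℤ) - (1 + 1 : ℕ))) h1
    simp only [HahnSeries.coeff_smul, HahnSeries.coeff_add, HahnSeries.coeff_sub, hd, hp,
      laurentOfCoeffs_coeff 2, smul_eq_mul, Nat.cast_one, Complex.ofReal_sub] at this
    exact this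
  · have := congrArg (fun s => HahnSeries.coeff s ((m : ℤ) - (1 + 1 : ℕ))) h2
    simp only [HahnSeries.coeff_smul, HahnSeries.coeff_add, HahnSeries.coeff_sub, hd, hp,
      laurentOfCoeffs_coeff 2, smul_eq_mul, Nat.cast_one, Complex.ofReal_sub] at this
    exact this
  · have := congrArg (fun s => HahnSeries.coeff s ((m : ℤ) - (1 + 1 : ℕ))) h3
    simp only [HahnSeries.coeff_smul, HahnSeries.coeff_add, HahnSeries.coeff_sub, hd, hp,
      laurentOfCoeffs_coeff 2, smul_eq_mul, Nat.cast_one, Complex.ofReal_sub] at this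
    exact this
  · have := congrArg (fun s => HahnSeries.coeff s ((m : ℤ) - (2 + 1 : ℕ))) h4
    simp only [HahnSeries.coeff_sub, hd, hq, Nat.cast_ofNat] at this
    exact this
  · have := congrArg (fun s => HahnSeries.coeff s ((m : ℤ) - (2 + 1 : ℕ))) h5
    simp only [HahnSeries.coeff_sub, hd, hq, Nat.cast_ofNat] at this
    exact this
  · have := congrArg (fun s => HahnSeries.coeff s ((m : ℤ) - (2 + 1 : ℕ))) h6
    simp only [HahnSeries.coeff_sub, hd, hq, Nat.cast_ofNat] at this
    exact this

theorem IsSeriesSolution.isLeading (h : b.IsSeriesSolution v) : b.IsLeading (v 0) := by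
  obtain ⟨h1, h2, h3, h4, h5, h6⟩ := h.coeff_eq 0
  simp only [Finset.Nat.antidiagonal_zero, Finset.sum_singleton, Nat.cast_zero] at h1 h2 h3 h4 h5 h6
  constructor
  · linear_combination h1
  · linear_combination h2
  · linear_combination h3
  · linear_combination h4
  · linear_combination h5
  · linear_combination h6

theorem IsSeriesSolution.satisfiesRecursion (h : b.IsSeriesSolution v) {m : ℕ} (hm : 1 ≤ m) :
    b.SatisfiesRecursion v m := by
  obtain ⟨h1, h2, h3, h4, h5, h6⟩ := h.coeff_eq m
  have hs : ∀ i j, ∑ ij ∈ Finset.HasAntidiagonal.antidiagonal m, v ij.1 i * v ij.2 j =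
      v 0 i * v m j + v m i * v 0 j + ∑ k ∈ Finset.Ioo 0 m, v k i * v (m - k) j := fun i j =>
    sum_antidiagonal_eq_add_sum_Ioo (fun k l => v k i * v l j) hm
  rw [hs] at h1 h2 h3
  rw [hs, hs] at h4 h5 h6
  rw [SatisfiesRecursion]
  ext i
  rw [recursionRHS, Finset.sum_apply]
  fin_cases i <;>
    simp only [Fin.zero_eta, Fin.mk_one, Fin.reduceFinMk, recursionMatrix, Matrix.mulVec,
      dotProduct, Fin.sum_univ_six, Matrix.of_apply, Matrix.cons_val, mul_assoc,
      Finset.sum_sub_distrib, ← Finset.mul_sum]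
  · linear_combination h1
  · linear_combination h2
  · linear_combination h3
  · linear_combination h4
  · linear_combination h5
  · linear_combination h6

end Series

end HeavyBody

/-! ### Families with five arbitrary constants -/

theorem sum_natCast_count_cons_le (T : Finset ℕ) (a : ℂ) (S : Multiset ℂ) :
    ∑ m ∈ T, (a ::ₘ S).count (m : ℂ) ≤ ∑ m ∈ T, S.count (m : ℂ) + 1 := by
  simp only [Multiset.count_cons, Finset.sum_add_distrib, Finset.sum_boole, Nat.cast_id]
  refine Nat.add_le_add_left (Finset.card_le_one.2 ?_) _
  intro x hx y hy
  exact Nat.cast_injective ((Finset.mem_filter.1 hx).2.trans (Finset.mem_filter.1 hy).2.symm)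

theorem sum_natCast_count_cons_of_forall_ne {T : Finset ℕ} {a : ℂ} (S : Multiset ℂ)
    (h : ∀ m ∈ T, (m : ℂ) ≠ a) :
    ∑ m ∈ T, (a ::ₘ S).count (m : ℂ) = ∑ m ∈ T, S.count (m : ℂ) :=
  Finset.sum_congr rfl fun m hm => Multiset.count_cons_of_ne (h m hm) S

/-- In the multiset `{-1, 2, 3, 4, ρ, σ}` with `ρ + σ = 1` there are at most four positive
integers. -/
theorem sum_natCast_count_roots_le {ρ σ : ℂ} (h : ρ + σ = 1) (M : ℕ) :
    ∑ m ∈ Finset.Ico 1 M, (({-1, 2, 3, 4} + {ρ, σ} : Multiset ℂ)).count (m : ℂ) ≤ 4 := by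
  set T := Finset.Ico 1 M with hT
  have hpair : ∑ m ∈ T, (({ρ, σ} : Multiset ℂ)).count (m : ℂ) ≤ 1 := by
    have e0 : ∑ m ∈ T, (0 : Multiset ℂ).count (m : ℂ) = 0 := by simp
    by_cases h1 : ∀ m ∈ T, (m : ℂ) ≠ ρ
    · have := sum_natCast_count_cons_of_forall_ne (σ ::ₘ 0) h1
      have := sum_natCast_count_cons_le T σ 0
      change ∑ m ∈ T, (ρ ::ₘ σ ::ₘ 0).count (m : ℂ) ≤ 1
      omega
    by_cases h2 : ∀ m ∈ T, (m : ℂ) ≠ σ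
    · have := sum_natCast_count_cons_of_forall_ne 0 h2
      have := sum_natCast_count_cons_le T ρ (σ ::ₘ 0)
      change ∑ m ∈ T, (ρ ::ₘ σ ::ₘ 0).count (m : ℂ) ≤ 1
      omega
    push Not at h1 h2
    obtain ⟨x, hx, rfl⟩ := h1
    obtain ⟨y, hy, rfl⟩ := h2
    have := natCast_add_eq_one h
    have := Finset.mem_Ico.1 hx
    have := Finset.mem_Ico.1 hy
    omega
  have e1 := sum_natCast_count_cons_le T 4 {ρ, σ}
  have e2 := sum_natCast_count_cons_le T 3 (4 ::ₘ {ρ, σ})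
  have e3 := sum_natCast_count_cons_le T 2 (3 ::ₘ 4 ::ₘ {ρ, σ})
  have e4 := sum_natCast_count_cons_of_forall_ne (T := T) (a := -1) (2 ::ₘ 3 ::ₘ 4 ::ₘ {ρ, σ})
    fun m _ h => absurd (by linear_combination h) (Nat.cast_add_one_ne_zero (R := ℂ) m)
  change ∑ m ∈ T, (-1 ::ₘ 2 ::ₘ 3 ::ₘ 4 ::ₘ {ρ, σ} : Multiset ℂ).count (m : ℂ) ≤ 4
  omega

namespace HeavyBody

section Family

variable {b : HeavyBody}

theorem differentiable_recursionMatrix_apply (b : HeavyBody) (m : ℂ) (i j : Fin 6) :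
    Differentiable ℂ fun v => b.recursionMatrix v m i j := by
  fin_cases i <;> fin_cases j <;>
    simp only [Fin.zero_eta, Fin.mk_one, Fin.reduceFinMk, recursionMatrix, Matrix.of_apply,
      Matrix.cons_val] <;> fun_prop

/-- In a family of solutions of the recursion, the derivative of the first coefficient that is not
stationary is in the kernel of the recursion matrix. -/
theorem recursionMatrix_mulVec_deriv {φ : ℂ → ℕ → Fin 6 → ℂ} {z : ℂ} {w : ℕ → Fin 6 → ℂ} {m : ℕ}
    (hm : 1 ≤ m) (hφ : ∀ᶠ x in 𝓝 z, b.SatisfiesRecursion (φ x) m)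
    (hd : ∀ k, HasDerivAt (fun x => φ x k) (w k) z) (hw : ∀ k < m, w k = 0) :
    (b.recursionMatrix (φ z 0) m).mulVec (w m) = 0 := by
  have hc : ∀ k i, HasDerivAt (fun x => φ x k i) (w k i) z := fun k => hasDerivAt_pi.1 (hd k)
  have hc0 : ∀ k < m, ∀ i, HasDerivAt (fun x => φ x k i) 0 z := fun k hk i => by
    simpa [hw k hk] using hc k i
  have hprod : ∀ k ∈ Finset.Ioo 0 m, ∀ i j,
      HasDerivAt (fun x => φ x k i * φ x (m - k) j) 0 z := fun k hk i j => by
    have hk' := Finset.mem_Ioo.1 hk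
    simpa using (hc0 k hk'.2 i).fun_mul (hc0 (m - k) (by omega) j)
  have hconst : ∀ k ∈ Finset.Ioo 0 m, ∀ i j, ∀ a : ℂ,
      HasDerivAt (fun x => a * φ x k i * φ x (m - k) j) 0 z := fun k hk i j a => by
    simpa [mul_assoc] using (hprod k hk i j).const_mul a
  have hsub : ∀ k ∈ Finset.Ioo 0 m, ∀ i j i' j',
      HasDerivAt (fun x => φ x k i * φ x (m - k) j - φ x k i' * φ x (m - k) j') 0 z :=
    fun k hk i j i' j' => by simpa using (hprod k hk i j).fun_sub (hprod k hk i' j')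
  ext i
  have hR : HasDerivAt (fun x => b.recursionRHS (φ x) m i) 0 z := by
    simp only [recursionRHS, Finset.sum_apply]
    refine (HasDerivAt.fun_sum (A' := fun _ => 0) fun k hk => ?_).congr_deriv
      Finset.sum_const_zero
    fin_cases i <;> simp only [Fin.zero_eta, Fin.mk_one, Fin.reduceFinMk, Matrix.cons_val]
    · exact hconst k hk _ _ _
    · exact hconst k hk _ _ _
    · exact hconst k hk _ _ _
    · exact hsub k hk _ _ _ _
    · exact hsub k hk _ _ _ _
    · exact hsub k hk _ _ _ _
  have hM : ∀ j, HasDerivAt (fun x => b.recursionMatrix (φ x 0) m i j) 0 z := fun j => by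
    have := (b.differentiable_recursionMatrix_apply m i j (φ z 0)).hasFDerivAt.comp_hasDerivAt z
      (hd 0)
    rwa [hw 0 hm, map_zero] at this
  have hL : HasDerivAt (fun x => ∑ j, b.recursionMatrix (φ x 0) m i j * φ x m j)
      (∑ j, (0 * φ z m j + b.recursionMatrix (φ z 0) m i j * w m j)) z :=
    HasDerivAt.fun_sum fun j _ => (hM j).fun_mul (hc m j)
  have := hL.unique (hR.congr_of_eventuallyEq (hφ.mono fun x hx => hx.apply i))
  simpa [Matrix.mulVec, dotProduct] using this

/-- The directions in which the coefficients of index below `m` are stationary, for a family of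
coefficients with the differentials `D`. -/
def stationaryDirections {n : ℕ} (D : ℕ → (Fin n → ℂ) →ₗ[ℂ] (Fin 6 → ℂ)) (m : ℕ) :
    Submodule ℂ (Fin n → ℂ) :=
  ⨅ k ∈ Finset.range m, LinearMap.ker (D k)

theorem mem_stationaryDirections {n : ℕ} {D : ℕ → (Fin n → ℂ) →ₗ[ℂ] (Fin 6 → ℂ)} {m : ℕ}
    {w : Fin n → ℂ} : w ∈ stationaryDirections D m ↔ ∀ k < m, D k w = 0 := by
  simp [stationaryDirections, Submodule.mem_iInf]

theorem finrank_stationaryDirections_le {n : ℕ} {D : ℕ → (Fin n → ℂ) →ₗ[ℂ] (Fin 6 → ℂ)} {m : ℕ}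
    {V : Submodule ℂ (Fin 6 → ℂ)} (hV : ∀ w ∈ stationaryDirections D m, D m w ∈ V) :
    Module.finrank ℂ (stationaryDirections D m) ≤
      Module.finrank ℂ (stationaryDirections D (m + 1)) + Module.finrank ℂ V := by
  let f := (D m).comp (stationaryDirections D m).subtype
  have hf : ∀ w, f w = D m w := fun w => rfl
  have h1 := LinearMap.finrank_range_add_finrank_ker f
  have h2 : LinearMap.range f ≤ V := by
    rintro _ ⟨w, rfl⟩
    exact hV w w.2
  have h3 : (LinearMap.ker f).map (stationaryDirections D m).subtype ≤
      stationaryDirections D (m + 1) := by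
    rintro _ ⟨w, hw, rfl⟩
    rw [mem_stationaryDirections]
    intro k hk
    rcases Nat.lt_succ_iff_lt_or_eq.1 hk with hk | rfl
    · exact mem_stationaryDirections.1 w.2 k hk
    · exact hw
  have h4 := Submodule.finrank_mono h2
  have h5 := Submodule.finrank_mono h3
  rw [Submodule.finrank_map_subtype_eq] at h5
  omega

theorem exists_stationaryDirections_eq_bot {n : ℕ} {D : ℕ → (Fin n → ℂ) →ₗ[ℂ] (Fin 6 → ℂ)}
    (hD : ∀ w, (∀ m, D m w = 0) → w = 0) : ∃ M, 1 ≤ M ∧ stationaryDirections D M = ⊥ := by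
  let f : ℕ →o (Submodule ℂ (Fin n → ℂ))ᵒᵈ :=
    ⟨fun m => OrderDual.toDual (stationaryDirections D m), fun m m' h w hw =>
      mem_stationaryDirections.2 fun k hk => mem_stationaryDirections.1 hw k (hk.trans_le h)⟩
  obtain ⟨M, hM⟩ := IsArtinian.monotone_stabilizes f
  have hM' : ∀ m, M ≤ m → stationaryDirections D M = stationaryDirections D m := hM
  refine ⟨M + 1, by omega, ?_⟩
  rw [← hM' (M + 1) (by omega), Submodule.eq_bot_iff]
  intro w hw
  refine hD w fun m => ?_
  rw [hM' (M + m + 1) (by omega)] at hw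
  exact mem_stationaryDirections.1 hw m (by omega)

/-- Five independent constants can enter only if one of them enters at the index `0`: each constant
enters at a root of the determinant, and at most four of the roots are positive integers. The
leading coefficients then vary along a curve. -/
theorem HasGeneralLaurentSolution.seriesConditions (h : b.HasGeneralLaurentSolution) :
    b.SeriesConditions := by
  obtain ⟨U, v, hU, hdiff, hsol, c₀, hc₀, hind⟩ := h
  let D : ℕ → (Fin 5 → ℂ) →ₗ[ℂ] (Fin 6 → ℂ) := fun m => (fderiv ℂ (fun c => v c m) c₀).toLinearMap
  have hD : ∀ m w, D m w = fderiv ℂ (fun c => v c m) c₀ w := fun m w => rfl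
  -- the complex lines through `c₀`
  have hline : ∀ w : Fin 5 → ℂ, Continuous fun z : ℂ => c₀ + z • w := fun w => by fun_prop
  have hopen : ∀ w : Fin 5 → ℂ, IsOpen ((fun z : ℂ => c₀ + z • w) ⁻¹' U) := fun w =>
    hU.preimage (hline w)
  have hmem : ∀ w : Fin 5 → ℂ, (0 : ℂ) ∈ (fun z : ℂ => c₀ + z • w) ⁻¹' U := fun w => by
    simpa using hc₀
  have hev : ∀ w : Fin 5 → ℂ, ∀ᶠ z : ℂ in 𝓝 0, c₀ + z • w ∈ U := fun w =>
    (hopen w).mem_nhds (hmem w)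
  have hder : ∀ w m, HasDerivAt (fun z : ℂ => v (c₀ + z • w) m) (D m w) 0 := by
    intro w m
    have h1 : HasDerivAt (fun z : ℂ => c₀ + z • w) w 0 := by
      simpa using ((hasDerivAt_id (0 : ℂ)).smul_const w).const_add c₀
    have h2 : HasFDerivAt (fun c => v c m) (fderiv ℂ (fun c => v c m) c₀)
        (c₀ + (0 : ℂ) • w) := by
      simpa using ((hdiff m).differentiableAt (hU.mem_nhds hc₀)).hasFDerivAt
    exact h2.comp_hasDerivAt (0 : ℂ) h1
  have hlead := (hsol c₀ hc₀).1.isLeading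
  obtain ⟨ρ, σ, hsum, hroots⟩ := hlead.exists_roots (hsol c₀ hc₀).2
  -- each step of the filtration by stationary directions is at most the multiplicity of a root
  have hstep : ∀ m, 1 ≤ m → Module.finrank ℂ (stationaryDirections D m) ≤
      Module.finrank ℂ (stationaryDirections D (m + 1)) +
        (b.kowalevskiMatrix (v c₀ 0)).charpoly.roots.count (m : ℂ) := by
    intro m hm
    refine (finrank_stationaryDirections_le
      (V := LinearMap.ker (b.recursionMatrix (v c₀ 0) m).mulVecLin) fun w hw => ?_).trans
      (Nat.add_le_add_left (b.finrank_ker_recursionMatrix_le (v c₀ 0) m) _)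
    have := recursionMatrix_mulVec_deriv (b := b) (φ := fun z => v (c₀ + z • w)) hm
      ((hev w).mono fun z hz => (hsol _ hz).1.satisfiesRecursion hm) (hder w)
      (mem_stationaryDirections.1 hw)
    simpa using this
  obtain ⟨M, hM1, hM⟩ := exists_stationaryDirections_eq_bot (D := D) hind
  have hcount : ∀ N, 1 ≤ N → Module.finrank ℂ (stationaryDirections D 1) ≤
      Module.finrank ℂ (stationaryDirections D N) +
        ∑ m ∈ Finset.Ico 1 N, (b.kowalevskiMatrix (v c₀ 0)).charpoly.roots.count (m : ℂ) := by
    intro N hN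
    induction N, hN using Nat.le_induction with
    | base => simp
    | succ N hN ih =>
      rw [Finset.sum_Ico_succ_top hN]
      have := hstep N hN
      omega
  have h4 := hcount M hM1
  rw [hM, finrank_bot, hroots] at h4
  have h4' := sum_natCast_count_roots_le hsum M
  -- hence not every direction is stationary for the leading coefficients
  obtain ⟨w, hw⟩ : ∃ w, D 0 w ≠ 0 := by
    by_contra! hw
    have htop : stationaryDirections D 1 = ⊤ := by
      rw [Submodule.eq_top_iff']
      intro w
      rw [mem_stationaryDirections]
      intro k hk
      obtain rfl : k = 0 := by omega
      exact hw w
    rw [htop, finrank_top, Module.finrank_fin_fun] at h4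
    omega
  refine seriesConditions_of_curve (φ := fun z => v (c₀ + z • w) 0) (hopen w) (hmem w) ?_
    (fun x hx => (hsol _ hx).1.isLeading) (fun x hx => (hsol _ hx).2) ?_
  · exact (hdiff 0).comp (by fun_prop) (fun x hx => hx)
  · rw [(hder w 0).deriv]
    exact hw

end Family

end HeavyBody

/-! ### Curves in the Lagrange and Kowalevski cases -/

namespace HeavyBody

section Examples

variable {b : HeavyBody}

/-- The leading coefficients with the angular velocity `(p, q, r)` and
`(f₀, g₀, h₀) = c (e - (e × ω) / 2)`, where `e = Mg (x₀, y₀, z₀)`. -/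
def rotationLeading (b : HeavyBody) (c p q r : ℂ) : Fin 6 → ℂ :=
  ![p, q, r, c * b.Mg * (b.x₀ - (b.y₀ * r - b.z₀ * q) / 2),
    c * b.Mg * (b.y₀ - (b.z₀ * p - b.x₀ * r) / 2),
    c * b.Mg * (b.z₀ - (b.x₀ * q - b.y₀ * p) / 2)]

/-- If the angular velocity is a principal direction orthogonal to the direction of the centre of
gravity, with `ω² = -4`, it belongs to leading coefficients. -/
theorem isLeading_rotationLeading {c l p q r : ℂ}
    (hc : c * b.Mg ^ 2 * (b.x₀ ^ 2 + b.y₀ ^ 2 + b.z₀ ^ 2) = -2 * l)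
    (hp : b.A * p = l * p) (hq : b.B * q = l * q) (hr : b.C * r = l * r)
    (he : b.x₀ * p + b.y₀ * q + b.z₀ * r = 0) (hs : p ^ 2 + q ^ 2 + r ^ 2 = -4) :
    b.IsLeading (b.rotationLeading c p q r) := by
  constructor <;> simp only [rotationLeading, Matrix.cons_val]
  · linear_combination -hp - r * hq + q * hr - p / 2 * hc + c * b.Mg ^ 2 * b.x₀ / 2 * he
  · linear_combination -hq - p * hr + r * hp - q / 2 * hc + c * b.Mg ^ 2 * b.y₀ / 2 * he
  · linear_combination -hr - q * hp + p * hq - r / 2 * hc + c * b.Mg ^ 2 * b.z₀ / 2 * he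
  · linear_combination c * b.Mg * (p / 2 * he - b.x₀ / 2 * hs)
  · linear_combination c * b.Mg * (q / 2 * he - b.y₀ / 2 * hs)
  · linear_combination c * b.Mg * (r / 2 * he - b.z₀ / 2 * hs)

theorem leadingNonzero_rotationLeading {c p q r : ℂ} (hc : c ≠ 0)
    (hN : (b.x₀ ^ 2 + b.y₀ ^ 2 + b.z₀ ^ 2 : ℂ) ≠ 0) :
    LeadingNonzero (b.rotationLeading c p q r) := by
  by_contra h
  simp only [LeadingNonzero, rotationLeading, Matrix.cons_val, not_or, not_not, mul_eq_zero, hc,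
    b.Mg_ne_zero, false_or] at h
  obtain ⟨h1, h2, h3⟩ := h
  exact hN (by linear_combination b.x₀ * h1 + b.y₀ * h2 + b.z₀ * h3)

/-- A plane of principal directions that is orthogonal to the direction of the centre of gravity
yields a curve of leading coefficients, along which the angular velocity rotates in that plane. -/
theorem seriesConditions_of_rotation {l : ℂ} {u w : Fin 3 → ℂ} (hl : l ≠ 0)
    (hN : (b.x₀ ^ 2 + b.y₀ ^ 2 + b.z₀ ^ 2 : ℂ) ≠ 0)
    (hu0 : b.A * u 0 = l * u 0) (hu1 : b.B * u 1 = l * u 1) (hu2 : b.C * u 2 = l * u 2)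
    (hw0 : b.A * w 0 = l * w 0) (hw1 : b.B * w 1 = l * w 1) (hw2 : b.C * w 2 = l * w 2)
    (heu : b.x₀ * u 0 + b.y₀ * u 1 + b.z₀ * u 2 = 0)
    (hew : b.x₀ * w 0 + b.y₀ * w 1 + b.z₀ * w 2 = 0)
    (huu : u 0 ^ 2 + u 1 ^ 2 + u 2 ^ 2 = -4) (hww : w 0 ^ 2 + w 1 ^ 2 + w 2 ^ 2 = -4)
    (huw : u 0 * w 0 + u 1 * w 1 + u 2 * w 2 = 0) : b.SeriesConditions := by
  obtain ⟨c, hc⟩ : ∃ c : ℂ, c * b.Mg ^ 2 * (b.x₀ ^ 2 + b.y₀ ^ 2 + b.z₀ ^ 2) = -2 * l :=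
    ⟨-2 * l / (b.Mg ^ 2 * (b.x₀ ^ 2 + b.y₀ ^ 2 + b.z₀ ^ 2)), by
      have := b.Mg_ne_zero
      field_simp⟩
  have hc0 : c ≠ 0 := by
    rintro rfl
    exact hl (by linear_combination (1 / 2) * hc)
  let ω : Fin 3 → ℂ → ℂ := fun i t => Complex.cos t * u i + Complex.sin t * w i
  have hω : ∀ i, HasDerivAt (ω i) (w i) 0 := fun i => by
    have := ((Complex.hasDerivAt_cos 0).mul_const (u i)).fun_add
      ((Complex.hasDerivAt_sin 0).mul_const (w i))
    simpa using this
  have hdiff : ∀ i, Differentiable ℂ (ω i) := fun i => by fun_prop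
  refine seriesConditions_of_curve (φ := fun t => b.rotationLeading c (ω 0 t) (ω 1 t) (ω 2 t))
    (z := 0) isOpen_univ trivial ?_ (fun t _ => ?_)
    (fun t _ => leadingNonzero_rotationLeading hc0 hN) ?_
  · refine Differentiable.differentiableOn (differentiable_pi.2 fun i => ?_)
    fin_cases i <;>
      simp only [Fin.zero_eta, Fin.mk_one, Fin.reduceFinMk, rotationLeading, Matrix.cons_val] <;>
      fun_prop
  · have hcs := Complex.sin_sq_add_cos_sq t
    refine isLeading_rotationLeading hc ?_ ?_ ?_ ?_ ?_
    · linear_combination Complex.cos t * hu0 + Complex.sin t * hw0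
    · linear_combination Complex.cos t * hu1 + Complex.sin t * hw1
    · linear_combination Complex.cos t * hu2 + Complex.sin t * hw2
    · linear_combination Complex.cos t * heu + Complex.sin t * hew
    · linear_combination Complex.cos t ^ 2 * huu + Complex.sin t ^ 2 * hww
        + 2 * Complex.cos t * Complex.sin t * huw - 4 * hcs
  · intro h0
    have hφ : DifferentiableAt ℂ (fun t => b.rotationLeading c (ω 0 t) (ω 1 t) (ω 2 t)) 0 := by
      refine differentiableAt_pi.2 fun i => ?_
      fin_cases i <;>
        simp only [Fin.zero_eta, Fin.mk_one, Fin.reduceFinMk, rotationLeading, Matrix.cons_val] <;>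
        fun_prop
    have hd := hasDerivAt_pi.1 hφ.hasDerivAt
    rw [h0] at hd
    have e0 : w 0 = 0 := (hω 0).unique (hd 0)
    have e1 : w 1 = 0 := (hω 1).unique (hd 1)
    have e2 : w 2 = 0 := (hω 2).unique (hd 2)
    simp [e0, e1, e2] at hww

theorem sum_sq_ne_zero_of_not_isEulerCase (hE : ¬ b.IsEulerCase) :
    (b.x₀ ^ 2 + b.y₀ ^ 2 + b.z₀ ^ 2 : ℂ) ≠ 0 := by
  intro h
  have h' : b.x₀ ^ 2 + b.y₀ ^ 2 + b.z₀ ^ 2 = 0 := by exact_mod_cast h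
  exact hE ⟨by nlinarith [sq_nonneg b.x₀, sq_nonneg b.y₀, sq_nonneg b.z₀],
    by nlinarith [sq_nonneg b.x₀, sq_nonneg b.y₀, sq_nonneg b.z₀],
    by nlinarith [sq_nonneg b.x₀, sq_nonneg b.y₀, sq_nonneg b.z₀]⟩

/-- The angular velocity rotates in the plane orthogonal to the centre of gravity, which consists of
principal directions. -/
theorem IsLagrangeCase.seriesConditions (h : b.IsLagrangeCase) (hE : ¬ b.IsEulerCase) :
    b.SeriesConditions := by
  have hN := sum_sq_ne_zero_of_not_isEulerCase hE
  have hI : (2 * Complex.I) ^ 2 = -4 := by rw [mul_pow, Complex.I_sq]; norm_num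
  have hxy : b.A = b.B → b.x₀ = 0 → b.y₀ = 0 → b.SeriesConditions := fun h hx hy => by
    apply seriesConditions_of_rotation (l := b.A) (u := ![2 * Complex.I, 0, 0])
      (w := ![0, 2 * Complex.I, 0]) b.A_ne_zero hN <;> simp [h, hx, hy, hI]
  rcases h with ⟨h, hx, hy⟩ | ⟨h, hy, hz⟩ | ⟨h, hz, hx⟩ | ⟨h, h'⟩
  · exact hxy h hx hy
  · apply seriesConditions_of_rotation (l := b.B) (u := ![0, 2 * Complex.I, 0])
      (w := ![0, 0, 2 * Complex.I]) b.B_ne_zero hN <;> simp [h, hy, hz, hI]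
  · apply seriesConditions_of_rotation (l := b.C) (u := ![0, 0, 2 * Complex.I])
      (w := ![2 * Complex.I, 0, 0]) b.C_ne_zero hN <;> simp [h, hz, hx, hI]
  · by_cases hxy0 : b.x₀ = 0 ∧ b.y₀ = 0
    · exact hxy h hxy0.1 hxy0.2
    -- an orthogonal frame of the plane orthogonal to `(x₀, y₀, z₀)`
    have hs0 : (b.x₀ ^ 2 + b.y₀ ^ 2 : ℂ) ≠ 0 := by
      intro h0
      have h0' : b.x₀ ^ 2 + b.y₀ ^ 2 = 0 := by exact_mod_cast h0
      exact hxy0 ⟨by nlinarith [sq_nonneg b.x₀, sq_nonneg b.y₀],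
        by nlinarith [sq_nonneg b.x₀, sq_nonneg b.y₀]⟩
    obtain ⟨s, hs⟩ := IsAlgClosed.exists_pow_nat_eq
      (-4 / (b.x₀ ^ 2 + b.y₀ ^ 2) : ℂ) (n := 2) two_pos
    obtain ⟨n, hn⟩ := IsAlgClosed.exists_pow_nat_eq
      (1 / (b.x₀ ^ 2 + b.y₀ ^ 2 + b.z₀ ^ 2) : ℂ) (n := 2) two_pos
    rw [eq_div_iff hs0] at hs
    rw [eq_div_iff hN] at hn
    have hB : (b.B : ℂ) = b.A := by rw [h]
    have hC : (b.C : ℂ) = b.A := by rw [h, h']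
    apply seriesConditions_of_rotation (l := b.A) (u := ![s * b.y₀, -s * b.x₀, 0])
      (w := ![n * s * (b.z₀ * b.x₀), n * s * (b.z₀ * b.y₀), -n * s * (b.x₀ ^ 2 + b.y₀ ^ 2)])
      b.A_ne_zero hN <;> simp only [Matrix.cons_val, hB, hC]
    · ring
    · ring
    · linear_combination hs
    · linear_combination n ^ 2 * (b.x₀ ^ 2 + b.y₀ ^ 2 + b.z₀ ^ 2) * hs - 4 * hn
    · ring

/-- In the Kowalevski case, the leading coefficients with constant `(f₀, g₀, h₀)` contain a line:
the component of the angular velocity along `(f₀, g₀, h₀)` is arbitrary. -/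
theorem IsKowalevskiCase.seriesConditions (h : b.IsKowalevskiCase) (hE : ¬ b.IsEulerCase) :
    b.SeriesConditions := by
  have hI : Complex.I ^ 2 = -1 := Complex.I_sq
  have hne : ∀ x y : ℝ, ¬ (x = 0 ∧ y = 0) → (x + Complex.I * y : ℂ) ≠ 0 := by
    intro x y hxy h0
    exact hxy ⟨by simpa using congrArg Complex.re h0, by simpa using congrArg Complex.im h0⟩
  have hg : ∀ x y d : ℝ, 0 < d → ¬ (x = 0 ∧ y = 0) →
      ∃ g : ℂ, g ≠ 0 ∧ b.Mg * (x + Complex.I * y) * g = -2 * d := by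
    intro x y d hd hxy
    have h1 := mul_ne_zero b.Mg_ne_zero (hne x y hxy)
    have h2 : (d : ℂ) ≠ 0 := by exact_mod_cast hd.ne'
    exact ⟨-2 * d / (b.Mg * (x + Complex.I * y)),
      div_ne_zero (mul_ne_zero (by norm_num) h2) h1, mul_div_cancel₀ _ h1⟩
  have key : ∀ a d : Fin 6 → ℂ, d ≠ 0 → (∀ s : ℂ, b.IsLeading (a + s • d)) →
      (∀ s : ℂ, LeadingNonzero (a + s • d)) → b.SeriesConditions := by
    intro a d hd h1 h2
    have hder : HasDerivAt (fun s : ℂ => a + s • d) d 0 := by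
      simpa using ((hasDerivAt_id (0 : ℂ)).smul_const d).const_add a
    refine seriesConditions_of_curve (φ := fun s => a + s • d) isOpen_univ (z := 0) trivial
      (by fun_prop) (fun s _ => h1 s) (fun s _ => h2 s) ?_
    rwa [hder.deriv]
  rcases h with ⟨hAB, hBC, hz⟩ | ⟨hBC, hCA, hx⟩ | ⟨hCA, hAB, hy⟩
  · obtain ⟨g, hg0, hg⟩ := hg b.x₀ b.y₀ b.C b.C_pos fun h => hE ⟨h.1, h.2, hz⟩
    have e1 : (b.A : ℂ) = 2 * b.C := by rw [hAB, hBC]; push_cast; rfl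
    have e2 : (b.B : ℂ) = 2 * b.C := by rw [hBC]; push_cast; rfl
    refine key ![0, 0, 2 * Complex.I, g, Complex.I * g, 0] ![1, Complex.I, 0, 0, 0, 0]
      (fun h => by simpa using congrFun h 0) (fun s => ?_) (fun s => ?_)
    · constructor <;> simp [e1, e2, hz]
      · linear_combination -2 * b.C * s * hI
      · ring
      · linear_combination -Complex.I * hg + b.Mg * g * b.y₀ * hI
      · linear_combination -2 * g * hI
      · ring
      · ring
    · simp [LeadingNonzero, hg0]
  · obtain ⟨g, hg0, hg⟩ := hg b.y₀ b.z₀ b.A b.A_pos fun h => hE ⟨hx, h.1, h.2⟩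
    have e1 : (b.B : ℂ) = 2 * b.A := by rw [hBC, hCA]; push_cast; rfl
    have e2 : (b.C : ℂ) = 2 * b.A := by rw [hCA]; push_cast; rfl
    refine key ![2 * Complex.I, 0, 0, 0, g, Complex.I * g] ![0, 1, Complex.I, 0, 0, 0]
      (fun h => by simpa using congrFun h 1) (fun s => ?_) (fun s => ?_)
    · constructor <;> simp [e1, e2, hx]
      · linear_combination -Complex.I * hg + b.Mg * g * b.z₀ * hI
      · linear_combination -2 * b.A * s * hI
      · ring
      · ring
      · linear_combination -2 * g * hI
      · ring
    · simp [LeadingNonzero, hg0]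
  · obtain ⟨g, hg0, hg⟩ := hg b.z₀ b.x₀ b.B b.B_pos fun h => hE ⟨h.2, hy, h.1⟩
    have e1 : (b.C : ℂ) = 2 * b.B := by rw [hCA, hAB]; push_cast; rfl
    have e2 : (b.A : ℂ) = 2 * b.B := by rw [hAB]; push_cast; rfl
    refine key ![0, 2 * Complex.I, 0, Complex.I * g, 0, g] ![Complex.I, 0, 1, 0, 0, 0]
      (fun h => by simpa using congrFun h 2) (fun s => ?_) (fun s => ?_)
    · constructor <;> simp [e1, e2, hy]
      · ring
      · linear_combination -Complex.I * hg + b.Mg * g * b.x₀ * hI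
      · linear_combination -2 * b.B * s * hI
      · ring
      · ring
      · linear_combination -2 * g * hI
    · simp [LeadingNonzero, hg0]

end Examples

end HeavyBody

/-! ### Finiteness of the leading coefficients in the other cases -/

/-- The equations between the leading angular velocity `(p, q, r)` and the number
`a = -Mg (x₀ f₀ + y₀ g₀ + z₀ h₀) / 2` that remain after the elimination of `(f₀, g₀, h₀)`. -/
structure AngularEquations (A B C x y z p q r a : ℂ) : Prop where
  sum_sq : p ^ 2 + q ^ 2 + r ^ 2 = -4
  sum_mul_sq : A * p ^ 2 + B * q ^ 2 + C * r ^ 2 = -4 * a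
  sum_sq_mul_sq : A ^ 2 * p ^ 2 + B ^ 2 * q ^ 2 + C ^ 2 * r ^ 2 = -4 * a ^ 2
  center : x * p * (A - 2 * a) + y * q * (B - 2 * a) + z * r * (C - 2 * a) = 0
  of_principal : A * p = a * p → B * q = a * q → C * r = a * r → x * p + y * q + z * r = 0

theorem AngularEquations.cyclic {A B C x y z p q r a : ℂ}
    (h : AngularEquations A B C x y z p q r a) : AngularEquations B C A y z x q r p a where
  sum_sq := by linear_combination h.sum_sq
  sum_mul_sq := by linear_combination h.sum_mul_sq
  sum_sq_mul_sq := by linear_combination h.sum_sq_mul_sq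
  center := by linear_combination h.center
  of_principal hB hC hA := by linear_combination h.of_principal hA hB hC

/-- The parameters of a body for which the squares of the components of the leading angular velocity
can have only finitely many values. -/
def FinitelyManySquares (A B C x y z : ℂ) : Prop :=
  ∃ S : Set ℂ, S.Finite ∧ ∀ p q r a : ℂ, AngularEquations A B C x y z p q r a →
    p ^ 2 ∈ S ∧ q ^ 2 ∈ S ∧ r ^ 2 ∈ S

theorem FinitelyManySquares.cyclic {A B C x y z : ℂ} (h : FinitelyManySquares A B C x y z) :
    FinitelyManySquares C A B z x y := by
  obtain ⟨S, hS, h⟩ := h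
  refine ⟨S, hS, fun p q r a hE => ?_⟩
  obtain ⟨h1, h2, h3⟩ := h q r p a hE.cyclic
  exact ⟨h3, h1, h2⟩

/-- For three different moments of inertia, `p²`, `q²`, `r²` are quadratic polynomials in `a`, and
the equation `x p (A - 2a) + y q (B - 2a) + z r (C - 2a) = 0` becomes polynomial in `a` after
squaring twice. The polynomial does not vanish identically: its values at `A`, `B`, `C` are the
fourth powers of `x`, `y`, `z`, up to factors different from zero. -/
theorem finitelyManySquares_of_ne {A B C x y z : ℂ} (hA : A ≠ 0) (hB : B ≠ 0) (hC : C ≠ 0)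
    (hAB : A ≠ B) (hBC : B ≠ C) (hCA : C ≠ A) (hxyz : ¬ (x = 0 ∧ y = 0 ∧ z = 0)) :
    FinitelyManySquares A B C x y z := by
  have dAB := sub_ne_zero.2 hAB
  have dBC := sub_ne_zero.2 hBC
  have dCA := sub_ne_zero.2 hCA
  have dBA := sub_ne_zero.2 hAB.symm
  have dCB := sub_ne_zero.2 hBC.symm
  have dAC := sub_ne_zero.2 hCA.symm
  let sq : ℂ → ℂ → ℂ → Polynomial ℂ := fun U V W =>
    Polynomial.C (-4 / ((U - V) * (U - W))) * (Polynomial.X - Polynomial.C V) *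
      (Polynomial.X - Polynomial.C W)
  let term : ℂ → ℂ → ℂ → ℂ → Polynomial ℂ := fun u U V W =>
    Polynomial.C (u ^ 2) * sq U V W * (Polynomial.C U - 2 * Polynomial.X) ^ 2
  let P : Polynomial ℂ := (term x A B C - term y B C A - term z C A B) ^ 2 -
    4 * term y B C A * term z C A B
  have hsq : ∀ U V W a, (sq U V W).eval a = -4 * (a - V) * (a - W) / ((U - V) * (U - W)) :=
    fun U V W a => by simp [sq]; ring
  have hterm : ∀ u U V W a, (term u U V W).eval a = u ^ 2 * (sq U V W).eval a * (U - 2 * a) ^ 2 :=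
    fun u U V W a => by simp [term]
  have hPe : ∀ a, P.eval a = ((term x A B C).eval a - (term y B C A).eval a -
      (term z C A B).eval a) ^ 2 - 4 * (term y B C A).eval a * (term z C A B).eval a :=
    fun a => by simp [P]
  have hself : ∀ U V W, U - V ≠ 0 → U - W ≠ 0 → (sq U V W).eval U = -4 := fun U V W h1 h2 => by
    rw [hsq]; field_simp
  have hleft : ∀ U V W, (sq U V W).eval V = 0 := fun U V W => by rw [hsq]; simp
  have hright : ∀ U V W, (sq U V W).eval W = 0 := fun U V W => by rw [hsq]; simp
  have hP : P ≠ 0 := by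
    intro h0
    have hA' := hPe A
    have hB' := hPe B
    have hC' := hPe C
    simp only [hterm, hleft, hright, hself A B C dAB dAC] at hA'
    simp only [hterm, hleft, hright, hself B C A dBC dBA] at hB'
    simp only [hterm, hleft, hright, hself C A B dCA dCB] at hC'
    rw [h0, Polynomial.eval_zero] at hA' hB' hC'
    have key : ∀ u U : ℂ, U ≠ 0 → 16 * (u * U) ^ 4 = 0 → u = 0 := fun u U hU h => by
      simpa [hU] using h
    exact hxyz ⟨key x A hA (by linear_combination -hA'), key y B hB (by linear_combination -hB'),
      key z C hC (by linear_combination -hC')⟩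
  have hR : {a | P.IsRoot a}.Finite := Polynomial.finite_setOfPred_isRoot hP
  refine ⟨(fun a => (sq A B C).eval a) '' {a | P.IsRoot a} ∪
    ((fun a => (sq B C A).eval a) '' {a | P.IsRoot a} ∪
      (fun a => (sq C A B).eval a) '' {a | P.IsRoot a}),
    (hR.image _).union ((hR.image _).union (hR.image _)), fun p q r a hE => ?_⟩
  obtain ⟨h1, h2, h3, h4, -⟩ := hE
  have hp : (sq A B C).eval a = p ^ 2 := by
    rw [hsq, div_eq_iff (mul_ne_zero dAB dAC)]
    linear_combination -B * C * h1 + (B + C) * h2 - h3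
  have hq : (sq B C A).eval a = q ^ 2 := by
    rw [hsq, div_eq_iff (mul_ne_zero dBC dBA)]
    linear_combination -C * A * h1 + (C + A) * h2 - h3
  have hr : (sq C A B).eval a = r ^ 2 := by
    rw [hsq, div_eq_iff (mul_ne_zero dCA dCB)]
    linear_combination -A * B * h1 + (A + B) * h2 - h3
  have hroot : a ∈ {a | P.IsRoot a} := by
    change P.eval a = 0
    rw [hPe, hterm, hterm, hterm, hp, hq, hr]
    -- with `ξ + η + ζ = 0`, this is `(ξ² - η² - ζ²)² = 4 η² ζ²`
    have h5 : x * p * (A - 2 * a) = -(y * q * (B - 2 * a) + z * r * (C - 2 * a)) := by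
      linear_combination h4
    have h6 : x ^ 2 * p ^ 2 * (A - 2 * a) ^ 2 =
        (y * q * (B - 2 * a) + z * r * (C - 2 * a)) ^ 2 := by
      rw [← neg_sq (y * q * (B - 2 * a) + _), ← h5]; ring
    rw [h6]
    ring
  exact ⟨Or.inl ⟨a, hroot, hp⟩, Or.inr (Or.inl ⟨a, hroot, hq⟩), Or.inr (Or.inr ⟨a, hroot, hr⟩)⟩

/-- For two equal moments of inertia, `a` is one of the principal moments. If it is the simple one,
the angular velocity is determined up to a factor by the isotropic vectors `(p, ±ip)`, and the
equation for the centre of gravity determines this factor unless `A = 2C` and `z = 0`. -/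
theorem finitelyManySquares_of_eq {A C x y z : ℝ} (hC : C ≠ 0) (hAC : A ≠ C)
    (hL : ¬ (x = 0 ∧ y = 0)) (hK : ¬ (A = 2 * C ∧ z = 0)) :
    FinitelyManySquares A A C x y z := by
  have hC' : (C : ℂ) ≠ 0 := by exact_mod_cast hC
  have hAC' : (A - C : ℂ) ≠ 0 := sub_ne_zero.2 (by exact_mod_cast hAC)
  have hn : (x ^ 2 + y ^ 2 : ℂ) ≠ 0 := by
    intro h0
    have h0' : x ^ 2 + y ^ 2 = 0 := by exact_mod_cast h0
    exact hL ⟨by nlinarith [sq_nonneg x, sq_nonneg y], by nlinarith [sq_nonneg x, sq_nonneg y]⟩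
  have hfac : (x + Complex.I * y : ℂ) * (x - Complex.I * y) = x ^ 2 + y ^ 2 := by
    linear_combination -(y : ℂ) ^ 2 * Complex.I_sq
  have hplus : (x + Complex.I * y : ℂ) ≠ 0 := fun h => hn (by rw [← hfac, h, zero_mul])
  have hminus : (x - Complex.I * y : ℂ) ≠ 0 := fun h => hn (by rw [← hfac, h, mul_zero])
  -- the value of `p²` for `q = ip` and for `q = -ip`
  let s₁ : ℂ := -4 * z ^ 2 * C ^ 2 / ((x + Complex.I * y) * (A - 2 * C)) ^ 2
  let s₂ : ℂ := -4 * z ^ 2 * C ^ 2 / ((x - Complex.I * y) * (A - 2 * C)) ^ 2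
  refine ⟨{0, -4, (-4 * y ^ 2 / (x ^ 2 + y ^ 2) : ℂ),
    (-4 * x ^ 2 / (x ^ 2 + y ^ 2) : ℂ), s₁, -s₁, s₂, -s₂},
    Set.toFinite _, fun p q r a hE => ?_⟩
  obtain ⟨h1, h2, h3, h4, h5⟩ := hE
  have ha : (a - C) * (a - A) = 0 := by
    linear_combination (1 / 4) * (h3 - (A + C) * h2 + A * C * h1)
  rcases mul_eq_zero.1 ha with ha | ha
  · obtain rfl : a = C := sub_eq_zero.1 ha
    have hpq : p ^ 2 + q ^ 2 = 0 := by
      refine (mul_eq_zero.1 (?_ : (A - C : ℂ) * (p ^ 2 + q ^ 2) = 0)).resolve_left hAC'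
      linear_combination h2 - C * h1
    have hr : r ^ 2 = -4 := by linear_combination h1 - hpq
    have hcen : (x * p + y * q) * (A - 2 * C) = z * r * C := by linear_combination h4
    have hA2 : (A - 2 * C : ℂ) ≠ 0 := by
      intro h0
      have hz : z * r * C = 0 := by rw [← hcen, h0, mul_zero]
      have hr0 : r ≠ 0 := by rintro rfl; norm_num at hr
      have hz0 : (z : ℂ) = 0 := by simpa [hr0, hC'] using hz
      exact hK ⟨by exact_mod_cast sub_eq_zero.1 h0, by exact_mod_cast hz0⟩
    have hq : (q - Complex.I * p) * (q + Complex.I * p) = 0 := by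
      linear_combination hpq - p ^ 2 * Complex.I_sq
    rcases mul_eq_zero.1 hq with hq | hq
    · have hp1 : p ^ 2 = s₁ := by
        rw [eq_div_iff (pow_ne_zero 2 (mul_ne_zero hplus hA2))]
        have : p * (x + Complex.I * y) * (A - 2 * C) = z * r * C := by
          linear_combination hcen - y * (A - 2 * C) * hq
        linear_combination (p * (x + Complex.I * y) * (A - 2 * C) + z * r * C) * this
          + z ^ 2 * C ^ 2 * hr
      have hq1 : q ^ 2 = -s₁ := by linear_combination hpq - hp1
      simp [hp1, hq1, hr]
    · have hp1 : p ^ 2 = s₂ := by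
        rw [eq_div_iff (pow_ne_zero 2 (mul_ne_zero hminus hA2))]
        have : p * (x - Complex.I * y) * (A - 2 * C) = z * r * C := by
          linear_combination hcen - y * (A - 2 * C) * hq
        linear_combination (p * (x - Complex.I * y) * (A - 2 * C) + z * r * C) * this
          + z ^ 2 * C ^ 2 * hr
      have hq1 : q ^ 2 = -s₂ := by linear_combination hpq - hp1
      simp [hp1, hq1, hr]
  · obtain rfl : a = A := sub_eq_zero.1 ha
    have hr : r = 0 := by
      have : (A - C : ℂ) * r ^ 2 = 0 := by linear_combination A * h1 - h2
      simpa using (mul_eq_zero.1 this).resolve_left hAC'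
    subst hr
    have h6 : (x * p + y * q : ℂ) = 0 := by
      linear_combination h5 rfl rfl (by rw [mul_zero, mul_zero])
    have hp : p ^ 2 = -4 * y ^ 2 / (x ^ 2 + y ^ 2) := by
      rw [eq_div_iff hn]
      linear_combination (x * p - y * q) * h6 + y ^ 2 * h1
    have hq : q ^ 2 = -4 * x ^ 2 / (x ^ 2 + y ^ 2) := by
      rw [eq_div_iff hn]
      linear_combination (y * q - x * p) * h6 + x ^ 2 * h1
    simp [hp, hq]

namespace HeavyBody

section Finiteness

variable {b : HeavyBody} {v w : Fin 6 → ℂ}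

/-- The coefficient of `ω` in `I ω`: the number `-e · γ / 2` for the leading
coefficients `γ = (f₀, g₀, h₀)` and `e = Mg (x₀, y₀, z₀)`. -/
def coeffOmega (b : HeavyBody) (v : Fin 6 → ℂ) : ℂ :=
  -(b.Mg * (b.x₀ * v 3 + b.y₀ * v 4 + b.z₀ * v 5)) / 2

/-- The coefficient of `γ` in `I ω`: the number `-e · ω / 2` for the leading
coefficients `ω = (p₀, q₀, r₀)` and `e = Mg (x₀, y₀, z₀)`. -/
def coeffGamma (b : HeavyBody) (v : Fin 6 → ℂ) : ℂ :=
  -(b.Mg * (b.x₀ * v 0 + b.y₀ * v 1 + b.z₀ * v 2)) / 2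

/-- In the leading coefficients, the angular momentum `I ω` is the combination
`-(e · γ) ω / 2 - (e · ω) γ / 2`. The first three equations are `I ω + I ω × ω + e × γ = 0`; their
cross products with `ω`, taken once and twice, yield `I ω × ω = (e · ω) γ` because of `ω² = -4`,
`γ × ω = -2 γ` and `γ · ω = 0`. -/
theorem IsLeading.angular_momentum (h : b.IsLeading v) (hn : LeadingNonzero v) :
    b.A * v 0 = b.coeffOmega v * v 0 + b.coeffGamma v * v 3 ∧
    b.B * v 1 = b.coeffOmega v * v 1 + b.coeffGamma v * v 4 ∧
    b.C * v 2 = b.coeffOmega v * v 2 + b.coeffGamma v * v 5 := by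
  have hs := h.omega_sq hn
  have hp := h.perp
  obtain ⟨h1, h2, h3, h4, h5, h6⟩ := h
  -- the components of `I ω × ω`
  obtain ⟨n₁, hn₁⟩ : ∃ n, n = (b.B - b.C) * v 1 * v 2 := ⟨_, rfl⟩
  obtain ⟨n₂, hn₂⟩ : ∃ n, n = (b.C - b.A) * v 2 * v 0 := ⟨_, rfl⟩
  obtain ⟨n₃, hn₃⟩ : ∃ n, n = (b.A - b.B) * v 0 * v 1 := ⟨_, rfl⟩
  obtain ⟨x, hx⟩ : ∃ x : ℂ, x = b.Mg * b.x₀ := ⟨_, rfl⟩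
  obtain ⟨y, hy⟩ : ∃ y : ℂ, y = b.Mg * b.y₀ := ⟨_, rfl⟩
  obtain ⟨z, hz⟩ : ∃ z : ℂ, z = b.Mg * b.z₀ := ⟨_, rfl⟩
  rw [← hn₁, mul_sub, ← mul_assoc, ← mul_assoc, ← hy, ← hz] at h1
  rw [← hn₂, mul_sub, ← mul_assoc, ← mul_assoc, ← hz, ← hx] at h2
  rw [← hn₃, mul_sub, ← mul_assoc, ← mul_assoc, ← hx, ← hy] at h3
  obtain ⟨s, hsd⟩ : ∃ s, s = x * v 0 + y * v 1 + z * v 2 := ⟨_, rfl⟩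
  obtain ⟨l, hld⟩ : ∃ l, l = b.A * v 0 ^ 2 + b.B * v 1 ^ 2 + b.C * v 2 ^ 2 := ⟨_, rfl⟩
  have hl : l = 2 * (x * v 3 + y * v 4 + z * v 5) := by
    linear_combination hld - v 0 * h1 - v 1 * h2 - v 2 * h3 - v 0 * hn₁ - v 1 * hn₂ - v 2 * hn₃
      + x * h4 + y * h5 + z * h6
  -- the cross product with `ω`
  have k1 : n₁ + l * v 0 + 4 * (b.A * v 0) + s * v 3 = 0 := by
    linear_combination v 1 * h3 - v 2 * h2 + hn₁ + v 0 * hld - v 2 * hn₂ + v 1 * hn₃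
      + b.A * v 0 * hs + x * hp + v 3 * hsd
  have k2 : n₂ + l * v 1 + 4 * (b.B * v 1) + s * v 4 = 0 := by
    linear_combination v 2 * h1 - v 0 * h3 + hn₂ + v 1 * hld - v 0 * hn₃ + v 2 * hn₁
      + b.B * v 1 * hs + y * hp + v 4 * hsd
  have k3 : n₃ + l * v 2 + 4 * (b.C * v 2) + s * v 5 = 0 := by
    linear_combination v 0 * h2 - v 1 * h1 + hn₃ + v 2 * hld - v 1 * hn₁ + v 0 * hn₂
      + b.C * v 2 * hs + z * hp + v 5 * hsd
  -- the second cross product with `ω`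
  have m1 : l * v 0 + 4 * (b.A * v 0) + 4 * n₁ - 2 * s * v 3 = 0 := by
    linear_combination v 2 * k2 - v 1 * k3 + v 0 * hld + b.A * v 0 * hs
      - v 2 * hn₂ + v 1 * hn₃ + 4 * hn₁ + s * h4
  have m2 : l * v 1 + 4 * (b.B * v 1) + 4 * n₂ - 2 * s * v 4 = 0 := by
    linear_combination v 0 * k3 - v 2 * k1 + v 1 * hld + b.B * v 1 * hs
      - v 0 * hn₃ + v 2 * hn₁ + 4 * hn₂ + s * h5
  have m3 : l * v 2 + 4 * (b.C * v 2) + 4 * n₃ - 2 * s * v 5 = 0 := by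
    linear_combination v 1 * k1 - v 0 * k2 + v 2 * hld + b.C * v 2 * hs
      - v 1 * hn₁ + v 0 * hn₂ + 4 * hn₃ + s * h6
  have ha : b.coeffOmega v = -(x * v 3 + y * v 4 + z * v 5) / 2 := by
    rw [coeffOmega, hx, hy, hz]; ring
  have hg : b.coeffGamma v = -s / 2 := by
    rw [coeffGamma, hsd, hx, hy, hz]; ring
  rw [ha, hg]
  refine ⟨?_, ?_, ?_⟩
  · linear_combination (4 * k1 - m1) / 12 - hl * v 0 / 4
  · linear_combination (4 * k2 - m2) / 12 - hl * v 1 / 4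
  · linear_combination (4 * k3 - m3) / 12 - hl * v 2 / 4

theorem IsLeading.isotropic (h : b.IsLeading v) : v 3 ^ 2 + v 4 ^ 2 + v 5 ^ 2 = 0 := by
  obtain ⟨-, -, -, h4, h5, h6⟩ := h
  linear_combination (-1 / 2) * (v 3 * h4 + v 4 * h5 + v 5 * h6)

theorem IsLeading.sum_mul_sq (h : b.IsLeading v) (hn : LeadingNonzero v) :
    b.A * v 0 ^ 2 + b.B * v 1 ^ 2 + b.C * v 2 ^ 2 = -4 * b.coeffOmega v := by
  obtain ⟨k1, k2, k3⟩ := h.angular_momentum hn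
  linear_combination v 0 * k1 + v 1 * k2 + v 2 * k3 + b.coeffOmega v * h.omega_sq hn
    + b.coeffGamma v * h.perp

theorem IsLeading.angularEquations (h : b.IsLeading v) (hn : LeadingNonzero v) :
    AngularEquations b.A b.B b.C b.x₀ b.y₀ b.z₀ (v 0) (v 1) (v 2) (b.coeffOmega v) := by
  obtain ⟨k1, k2, k3⟩ := h.angular_momentum hn
  refine ⟨h.omega_sq hn, h.sum_mul_sq hn, ?_, ?_, fun e1 e2 e3 => ?_⟩
  · linear_combination (b.A * v 0 + b.coeffOmega v * v 0 + b.coeffGamma v * v 3) * k1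
      + (b.B * v 1 + b.coeffOmega v * v 1 + b.coeffGamma v * v 4) * k2
      + (b.C * v 2 + b.coeffOmega v * v 2 + b.coeffGamma v * v 5) * k3
      + b.coeffOmega v ^ 2 * h.omega_sq hn + 2 * b.coeffOmega v * b.coeffGamma v * h.perp
      + b.coeffGamma v ^ 2 * h.isotropic
  · have ha : b.Mg * (b.x₀ * v 3 + b.y₀ * v 4 + b.z₀ * v 5) = -2 * b.coeffOmega v := by
      rw [coeffOmega]; ring
    have hg : b.Mg * (b.x₀ * v 0 + b.y₀ * v 1 + b.z₀ * v 2) = -2 * b.coeffGamma v := by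
      rw [coeffGamma]; ring
    refine mul_left_cancel₀ b.Mg_ne_zero ?_
    linear_combination b.Mg * (b.x₀ * k1 + b.y₀ * k2 + b.z₀ * k3) - b.coeffOmega v * hg
      + b.coeffGamma v * ha
  · -- `(f₀, g₀, h₀) ≠ 0` has the factor `-e · ω / 2`
    have hg : b.coeffGamma v = 0 := by
      by_contra hg
      rw [e1, left_eq_add, mul_eq_zero, or_iff_right hg] at k1
      rw [e2, left_eq_add, mul_eq_zero, or_iff_right hg] at k2
      rw [e3, left_eq_add, mul_eq_zero, or_iff_right hg] at k3
      simp [LeadingNonzero, k1, k2, k3] at hn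
    rw [coeffGamma] at hg
    refine (mul_eq_zero.1 (?_ : (b.Mg : ℂ) * _ = 0)).resolve_left b.Mg_ne_zero
    linear_combination -2 * hg

/-- The leading coefficients are determined by the angular velocity: it determines the numbers
`a` and `c` in `I ω = a ω + c γ`. If `c = 0`, then `a` is a principal moment, and `γ` is
determined as an eigenvector of `γ ↦ γ × ω` by `e · γ = -2 a ≠ 0`. -/
theorem IsLeading.eq_of_omega_eq (hv : b.IsLeading v) (hvn : LeadingNonzero v)
    (hw : b.IsLeading w) (hwn : LeadingNonzero w) (h0 : v 0 = w 0) (h1 : v 1 = w 1)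
    (h2 : v 2 = w 2) : v = w := by
  obtain ⟨k1, k2, k3⟩ := hv.angular_momentum hvn
  obtain ⟨l1, l2, l3⟩ := hw.angular_momentum hwn
  have hs := hw.omega_sq hwn
  have ha : b.coeffOmega v = b.coeffOmega w := by
    have e1 := hv.sum_mul_sq hvn
    have e2 := hw.sum_mul_sq hwn
    rw [h0, h1, h2] at e1
    linear_combination (e1 - e2) / 4
  have hg : b.coeffGamma v = b.coeffGamma w := by rw [coeffGamma, h0, h1, h2, coeffGamma]
  rw [ha, hg, h0] at k1
  rw [ha, hg, h1] at k2
  rw [ha, hg, h2] at k3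
  have key : v 3 = w 3 ∧ v 4 = w 4 ∧ v 5 = w 5 := by
    by_cases hg0 : b.coeffGamma w = 0
    · have ha0 : b.coeffOmega w ≠ 0 := by
        intro ha0
        rw [ha0, hg0, zero_mul, zero_mul, add_zero] at l1 l2 l3
        have e1 := (mul_eq_zero.1 l1).resolve_left b.A_ne_zero
        have e2 := (mul_eq_zero.1 l2).resolve_left b.B_ne_zero
        have e3 := (mul_eq_zero.1 l3).resolve_left b.C_ne_zero
        rw [e1, e2, e3] at hs
        norm_num at hs
      obtain ⟨-, -, -, p4, p5, p6⟩ := hv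
      have hperp := hw.perp
      obtain ⟨-, -, -, q4, q5, q6⟩ := hw
      rw [h0, h1, h2] at *
      have hvw : v 3 * w 3 + v 4 * w 4 + v 5 * w 5 = 0 := by
        linear_combination (-1 / 4) * (w 3 * p4 + w 4 * p5 + w 5 * p6
          + v 3 * q4 + v 4 * q5 + v 5 * q6)
      -- the cross product of the two vectors vanishes
      have c1 : v 4 * w 5 - v 5 * w 4 = 0 := by
        linear_combination (-1 / 2) * (w 5 * p5 - w 4 * p6 + w 0 * hvw - v 3 * hperp)
      have c2 : v 5 * w 3 - v 3 * w 5 = 0 := by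
        linear_combination (-1 / 2) * (w 3 * p6 - w 5 * p4 + w 1 * hvw - v 4 * hperp)
      have c3 : v 3 * w 4 - v 4 * w 3 = 0 := by
        linear_combination (-1 / 2) * (w 4 * p4 - w 3 * p5 + w 2 * hvw - v 5 * hperp)
      have ev : b.Mg * (b.x₀ * v 3 + b.y₀ * v 4 + b.z₀ * v 5) = -2 * b.coeffOmega w := by
        rw [← ha, coeffOmega]; ring
      have ew : b.Mg * (b.x₀ * w 3 + b.y₀ * w 4 + b.z₀ * w 5) = -2 * b.coeffOmega w := by
        rw [coeffOmega]; ring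
      refine ⟨mul_left_cancel₀ ha0 ?_, mul_left_cancel₀ ha0 ?_, mul_left_cancel₀ ha0 ?_⟩
      · linear_combination (-1 / 2) * (w 3 * ev - v 3 * ew + b.Mg * (b.y₀ * c3 - b.z₀ * c2))
      · linear_combination (-1 / 2) * (w 4 * ev - v 4 * ew + b.Mg * (b.z₀ * c1 - b.x₀ * c3))
      · linear_combination (-1 / 2) * (w 5 * ev - v 5 * ew + b.Mg * (b.x₀ * c2 - b.y₀ * c1))
    · exact ⟨mul_left_cancel₀ hg0 (by linear_combination l1 - k1),
        mul_left_cancel₀ hg0 (by linear_combination l2 - k2),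
        mul_left_cancel₀ hg0 (by linear_combination l3 - k3)⟩
  ext i
  fin_cases i
  exacts [h0, h1, h2, key.1, key.2.1, key.2.2]

theorem finite_setOf_isLeading (h : FinitelyManySquares b.A b.B b.C b.x₀ b.y₀ b.z₀) :
    {v | b.IsLeading v ∧ LeadingNonzero v}.Finite := by
  obtain ⟨S, hS, h⟩ := h
  have hT : {x : ℂ | x ^ 2 ∈ S}.Finite := by
    refine hS.preimage' fun c _ => ?_
    refine (Polynomial.finite_setOfPred_isRoot
      (Polynomial.X_pow_sub_C_ne_zero two_pos c)).subset fun x hx => ?_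
    have hx' : x ^ 2 = c := hx
    simp [hx']
  refine Set.Finite.of_injOn (f := fun v : Fin 6 → ℂ => (v 0, v 1, v 2))
    (fun v hv => ?_) (fun v hv w hw hvw => ?_) (hT.prod (hT.prod hT))
  · obtain ⟨h1, h2, h3⟩ := h _ _ _ _ (hv.1.angularEquations hv.2)
    exact ⟨h1, h2, h3⟩
  · simp only [Prod.mk.injEq] at hvw
    exact hv.1.eq_of_omega_eq hv.2 hw.1 hw.2 hvw.1 hvw.2.1 hvw.2.2

theorem finitelyManySquares (hE : ¬ b.IsEulerCase) (hL : ¬ b.IsLagrangeCase)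
    (hK : ¬ b.IsKowalevskiCase) : FinitelyManySquares b.A b.B b.C b.x₀ b.y₀ b.z₀ := by
  simp only [IsLagrangeCase, not_or] at hL
  simp only [IsKowalevskiCase, not_or] at hK
  obtain ⟨hL1, hL2, hL3, hL4⟩ := hL
  obtain ⟨hK1, hK2, hK3⟩ := hK
  by_cases hAB : b.A = b.B
  · have := finitelyManySquares_of_eq (A := b.A) (C := b.C) (x := b.x₀) (y := b.y₀) (z := b.z₀)
      b.C_pos.ne' (fun h => hL4 ⟨hAB, hAB ▸ h⟩) (fun h => hL1 ⟨hAB, h⟩)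
      (fun h => hK1 ⟨hAB, hAB ▸ h⟩)
    rwa [← hAB]
  by_cases hBC : b.B = b.C
  · have := finitelyManySquares_of_eq (A := b.B) (C := b.A) (x := b.y₀) (y := b.z₀) (z := b.x₀)
      b.A_pos.ne' (fun h => hAB h.symm) (fun h => hL2 ⟨hBC, h⟩)
      (fun h => hK2 ⟨hBC, hBC ▸ h⟩)
    rw [← hBC]
    exact this.cyclic
  by_cases hCA : b.C = b.A
  · have := finitelyManySquares_of_eq (A := b.C) (C := b.B) (x := b.z₀) (y := b.x₀) (z := b.y₀)
      b.B_pos.ne' (fun h => hBC h.symm) (fun h => hL3 ⟨hCA, h⟩)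
      (fun h => hK3 ⟨hCA, hCA ▸ h⟩)
    rw [← hCA]
    exact this.cyclic.cyclic
  refine finitelyManySquares_of_ne b.A_ne_zero b.B_ne_zero b.C_ne_zero ?_ ?_ ?_ ?_
  · exact_mod_cast hAB
  · exact_mod_cast hBC
  · exact_mod_cast hCA
  · exact fun h => hE ⟨by exact_mod_cast h.1, by exact_mod_cast h.2.1, by exact_mod_cast h.2.2⟩

theorem SeriesConditions.isLagrangeCase_or_isKowalevskiCase (h : b.SeriesConditions)
    (hE : ¬ b.IsEulerCase) : b.IsLagrangeCase ∨ b.IsKowalevskiCase := by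
  obtain ⟨s, hs, v, hv, hacc⟩ := h
  by_contra! hLK
  refine Set.Infinite.of_accPt (hacc (hv.leading.zero_mem_of_card hv.nonzero hs hv.det_eq_zero)) ?_
  exact (finite_setOf_isLeading (finitelyManySquares hE hLK.1 hLK.2)).subset fun w hw =>
    ⟨hw.leading, hw.nonzero⟩

end Finiteness

end HeavyBody

end

theorem mainTheorem1 (b : HeavyBody) :
    (b.HasGeneralLaurentSolution → b.SeriesConditions) ∧
    (¬ b.IsEulerCase → (b.SeriesConditions ↔ b.IsLagrangeCase ∨ b.IsKowalevskiCase)) :=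
  ⟨fun h => h.seriesConditions, fun hE =>
    ⟨fun h => h.isLagrangeCase_or_isKowalevskiCase hE, fun h =>
      h.elim (fun h => h.seriesConditions hE) fun h => h.seriesConditions hE⟩⟩
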